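/- **Setting.** Seller types lie in an interval $[\underline\theta,\overline\theta]$ and are distributed according to a probability measure $F$ on it with finitely many atoms. Producing quality $x\ge 0$ costs a seller of type $\theta$ the amount $C(x,\theta)$, where $C$ is twice continuously differentiable on $[0,\infty)\times[\underline\theta,\overline\theta]$ with $C_q\ge 0$, $C_\theta\le 0$, $C_{qq}\ge 0$, $C_{q\theta}\le 0$, $C(0,\theta)=0$ and $C_q(0,\theta)=0$. A rating system $(\pi,S)$ is a measurable space $S$ of signals with a Markov kernel $\pi(\cdot\mid x)$ from qualities to signals. Functions $q\ge 0$ (quality) and $\overline q$ (signaled quality) on $[\underline\theta,\overline\theta]$ *arise in an equilibrium* under $(\pi,S)$ if $q$ is $F$-integrable and there is a measurable price function $p\ge 0$ on $S$ with $p(s)=\mathbb E[q\mid s]$ (conditional expectation under the joint law of quality and signal when $\theta\sim F$ and type $\theta$ chooses $q(\theta)$; on the null set of off-path signals $p\geq 0$ is arbitrary) such that $\int_S p\,d\pi(\cdot\mid x)<\infty$ for all $x\ge 0$ and, for every type $\theta\in[\underline\theta,\overline\theta]$, $$\overline q(\theta)=\int_S p(s)\,\pi(ds\mid q(\theta)),\qquad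 q(\theta)\in\arg\max_{x\ge 0}\Big\{\int_S p(s)\,\pi(ds\mid x)-C(x,\theta)\Big\},\qquad \overline q(\theta)-C(q(\theta),\theta)\ge 0 .$$ **Proposition.** Let $q\ge 0$ and $\overline q$ be real functions on $[\underline\theta,\overline\theta]$, and put $\Pi(\theta)=\overline q(\theta)-C(q(\theta),\theta)$. Suppose that either $C$ is strictly submodular (that is, $C(y,\theta')-C(x,\theta')<C(y,\theta)-C(x,\theta)$ whenever $0\le x<y$ and $\theta<\theta'$), or $q$ is increasing. Then $q$ and $\overline q$ arise in an equilibrium under some rating system if and only if all of the following hold: 1. $\Pi$ is absolutely continuous (in particular continuous) on $[\underline\theta,\overline\theta]$, and at every $\theta\in(\underline\theta,\overline\theta)$ at which $\Pi$ is differentiable, $\Pi'(\theta)=-C_\theta(q(\theta),\theta)$; 2. $q$ and $\overline q$ are (weakly) increasing and $q$ $F$-majorizes $\overline q$, i.e. $$\int_{[\underline\theta,\theta]}\overline q\,dF\ \ge\ \int_{[\underline\theta,\theta]} q\,dF\quad\text{for all }\theta\in[\underline\theta,\overline\theta],\qquad \int_{[\underline\theta,\overline\theta]}\overline q\,dF=\int_{[\underline\theta,\overline\theta]}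 q\,dF;$$ 3. (participation) $\Pi(\theta)\ge 0$ for all $\theta\in[\underline\theta,\overline\theta]$. -/

import Mathlib

open Set MeasureTheory ProbabilityTheory

noncomputable section

namespace Rating

/-- Marginal cost of quality `C_q(x, θ)` (one-sided at `x = 0`). -/
def costQ (C : ℝ → ℝ → ℝ) (x θ : ℝ) : ℝ :=
  derivWithin (fun y => C y θ) (Ici 0) x

/-- `C_θ(x, θ)` on the type interval `[a, b]` (one-sided at the end points). -/
def costT (a b : ℝ) (C : ℝ → ℝ → ℝ) (x θ : ℝ) : ℝ :=
  derivWithin (fun t => C x t) (Icc a b) θ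

/-- `C_qq(x, θ)`. -/
def costQQ (C : ℝ → ℝ → ℝ) (x θ : ℝ) : ℝ :=
  derivWithin (fun y => costQ C y θ) (Ici 0) x

/-- `C_qθ(x, θ)`. -/
def costQT (a b : ℝ) (C : ℝ → ℝ → ℝ) (x θ : ℝ) : ℝ :=
  derivWithin (fun t => costQ C x t) (Icc a b) θ

/-- The assumptions on the cost `C(quality, type)`, for qualities in `[0, ∞)` and types in
`[a, b]`. -/
structure IsCostFunction (a b : ℝ) (C : ℝ → ℝ → ℝ) : Prop where
  contDiffOn : ContDiffOn ℝ 2 (fun z : ℝ × ℝ => C z.1 z.2) (Ici 0 ×ˢ Icc a b)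
  costQ_nonneg : ∀ x, 0 ≤ x → ∀ θ ∈ Icc a b, 0 ≤ costQ C x θ
  costT_nonpos : ∀ x, 0 ≤ x → ∀ θ ∈ Icc a b, costT a b C x θ ≤ 0
  costQQ_nonneg : ∀ x, 0 ≤ x → ∀ θ ∈ Icc a b, 0 ≤ costQQ C x θ
  costQT_nonpos : ∀ x, 0 ≤ x → ∀ θ ∈ Icc a b, costQT a b C x θ ≤ 0
  zero_cost : ∀ θ ∈ Icc a b, C 0 θ = 0
  zero_costQ : ∀ θ ∈ Icc a b, costQ C 0 θ = 0

/-- Strict submodularity: the cost of any increase in quality is strictly smaller for a higher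
type. -/
def StrictlySubmodular (a b : ℝ) (C : ℝ → ℝ → ℝ) : Prop :=
  ∀ x y, 0 ≤ x → x < y → ∀ θ ∈ Icc a b, ∀ θ' ∈ Icc a b, θ < θ' →
    C y θ' - C x θ' < C y θ - C x θ

/-- A rating system `(π, S)`: a signal space and, for each quality, a law of the signal.
(Only nonnegative qualities are ever used.) -/
structure RatingSystem where
  S : Type
  [measurableSpace : MeasurableSpace S]
  π : Kernel ℝ S
  [isMarkov : IsMarkovKernel π]

attribute [instance] RatingSystem.measurableSpace RatingSystem.isMarkov

/-- The joint law of (quality, signal), when the types are distributed according to `F`, type `θ`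
chooses the quality `q θ` and qualities are rated by `R`. -/
def jointLaw (F : Measure ℝ) (R : RatingSystem) (q : ℝ → ℝ) : Measure (ℝ × R.S) :=
  (F.map q).compProd R.π

/-- `p` is a competitive price function on signals: `p(s) = E[q | s]`, i.e. `p` composed with the
signal is a version of the conditional expectation of quality given the signal. The conditional
expectation leaves the price free on a null (off-path) set of signals; since a price is always the
mean of some belief about the nonnegative quality, it is nonnegative at every signal. -/
structure IsPrice (F : Measure ℝ) (R : RatingSystem) (q : ℝ → ℝ) (p : R.S → ℝ) : Prop where
  measurable : Measurable p
  nonneg : ∀ s, 0 ≤ p s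
  eq_condExp : (fun z : ℝ × R.S => p z.2) =ᵐ[jointLaw F R q]
    condExp (MeasurableSpace.comap (Prod.snd : ℝ × R.S → R.S) R.measurableSpace)
      (jointLaw F R q) (fun z : ℝ × R.S => z.1)

/-- `q` (qualities) and `qbar` (signaled qualities) arise in an equilibrium under the rating
system `R`, every type in `[a, b]` producing. -/
structure IsEquilibrium (a b : ℝ) (F : Measure ℝ) (C : ℝ → ℝ → ℝ) (R : RatingSystem)
    (p : R.S → ℝ) (q qbar : ℝ → ℝ) : Prop where
  integrable_quality : Integrable q F
  price : IsPrice F R q p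
  /-- Every feasible quality has a finite expected price. (As `p ≥ 0`, an expected price that is
  not finite is `+∞`, and then the sellers' problem would have no maximizer with a finite
  payoff.) -/
  integrable_price : ∀ x, 0 ≤ x → Integrable p (R.π x)
  signaled : ∀ θ ∈ Icc a b, qbar θ = ∫ s, p s ∂(R.π (q θ))
  /-- `q θ` is feasible and maximizes expected price minus cost over all feasible qualities. -/
  optimal : ∀ θ ∈ Icc a b, 0 ≤ q θ ∧ ∀ x, 0 ≤ x →
    (∫ s, p s ∂(R.π x)) - C x θ ≤ (∫ s, p s ∂(R.π (q θ))) - C (q θ) θ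
  participation : ∀ θ ∈ Icc a b, 0 ≤ (∫ s, p s ∂(R.π (q θ))) - C (q θ) θ

/-- `q` and `qbar` arise from an equilibrium for some rating system. -/
def ArisesInEquilibrium (a b : ℝ) (F : Measure ℝ) (C : ℝ → ℝ → ℝ) (q qbar : ℝ → ℝ) : Prop :=
  ∃ (R : RatingSystem) (p : R.S → ℝ), IsEquilibrium a b F C R p q qbar

/-- The profit `Π(θ) = qbar(θ) - C(q(θ), θ)`. -/
def profit (C : ℝ → ℝ → ℝ) (q qbar : ℝ → ℝ) (θ : ℝ) : ℝ :=
  qbar θ - C (q θ) θ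

/-- `Π` is absolutely continuous on `[a, b]`, and wherever it is differentiable in the interior,
`Π'(θ) = -C_θ(q(θ), θ)`. -/
def EnvelopeCondition (a b : ℝ) (C : ℝ → ℝ → ℝ) (q qbar : ℝ → ℝ) : Prop :=
  AbsolutelyContinuousOnInterval (profit C q qbar) a b ∧
    ∀ θ ∈ Ioo a b, DifferentiableAt ℝ (profit C q qbar) θ →
      deriv (profit C q qbar) θ = -costT a b C (q θ) θ

/-- `q` `F`-majorizes `qbar`. -/
def FMajorizes (a b : ℝ) (F : Measure ℝ) (q qbar : ℝ → ℝ) : Prop :=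
  (∀ θ ∈ Icc a b, ∫ t in Icc a θ, q t ∂F ≤ ∫ t in Icc a θ, qbar t ∂F) ∧
    ∫ t in Icc a b, qbar t ∂F = ∫ t in Icc a b, q t ∂F

/-- The envelope condition, monotonicity and majorization, together with participation. -/
def Implementable (a b : ℝ) (F : Measure ℝ) (C : ℝ → ℝ → ℝ) (q qbar : ℝ → ℝ) : Prop :=
  EnvelopeCondition a b C q qbar ∧
  (MonotoneOn q (Icc a b) ∧ MonotoneOn qbar (Icc a b) ∧ FMajorizes a b F q qbar) ∧
  ∀ θ ∈ Icc a b, 0 ≤ profit C q qbar θ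

end Rating

end

/-! Necessity. In an equilibrium every type may mimic every other: `qbar θ' - C (q θ') θ ≤ Π θ`.
Adding two such inequalities and using strict submodularity makes `q` increasing; since cost
increases in quality, `qbar` is then increasing as well. The same inequalities say that `Π + C (q
θ)` is minimal at `θ`, which gives a Lipschitz bound for `Π` and the envelope formula. Price is the
conditional mean of quality given the signal, and `qbar` is the mean price given quality, so
Jensen's inequality yields `∫ (c - qbar)⁺ ≤ ∫ (c - q)⁺` for every `c`; the choice `c = q θ` is
majorization.

Sufficiency. The envelope formula and monotonicity of `q` give the mimicking inequalities back
(`incentive_compatible`). Hence the price schedule `G x = min M (inf_θ (Π θ + C x θ))` is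
increasing, satisfies `G ∘ q = qbar` and tempts no type (`indirectPrice`). What remains is to
realize `G` by a rating: a kernel from qualities `x` to signals `s` with `E[s | x] = G x` and `E[x |
s] = s`, so that the signal is its own price.

Such a kernel exists because the law of quality majorizes `G` (`exists_kernel_of_majorized`). With
finitely many cells (`exists_signal_laws`), stretch the price away from its mean until a
majorization constraint binds, treat the two sides of the binding cut separately, and undo the
stretch by sending an uninformative signal with the complementary probability. The general case is a
weak limit of discretizations, disintegrated over quality and repaired on a null set. -/

/-! ### Signals with prescribed means: finitely many cells -/

/-- Finite version of the rating construction: `f`, `a`, `b` are the masses, quality integrals and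
price integrals of consecutive cells. -/
theorem exists_signal_laws {M : ℝ} (hM : 0 ≤ M) (n : ℕ) : ∀ f a b : ℕ → ℝ,
    (∀ k, 0 ≤ f k) → (∀ k, 0 ≤ a k) → (∀ k, a k ≤ M * f k) →
    (∀ k, f k = 0 → b k = 0) → (∀ k l, k ≤ l → b k * f l ≤ b l * f k) →
    (∀ k ≤ n, ∑ j ∈ Finset.range k, a j ≤ ∑ j ∈ Finset.range k, b j) →
    (∑ j ∈ Finset.range n, a j = ∑ j ∈ Finset.range n, b j) →
    ∃ w : ℕ → Measure (Icc (0 : ℝ) M), (∀ k, IsProbabilityMeasure (w k)) ∧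
      (∀ φ : C(Icc (0 : ℝ) M, ℝ),
        ∑ k ∈ Finset.range n, ∫ s, (a k - s * f k) * φ s ∂(w k) = 0) ∧
      ∀ k < n, f k * ∫ s, (s : ℝ) ∂(w k) = b k := by
  induction n using Nat.strong_induction_on with
  | _ n ih =>
  intro f a b hf ha haM hfb hmono hmaj htot
  have hF0 : 0 ≤ ∑ j ∈ Finset.range n, f j := Finset.sum_nonneg fun _ _ => hf _
  rcases hF0.eq_or_lt with hF | hF
  · have hfz : ∀ k < n, f k = 0 := fun k hk =>
      (Finset.sum_eq_zero_iff_of_nonneg fun _ _ => hf _).1 hF.symm k (Finset.mem_range.2 hk)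
    refine ⟨fun _ => Measure.dirac ⟨0, le_rfl, hM⟩, fun _ => inferInstance, fun φ => ?_,
      fun k hk => ?_⟩
    · refine Finset.sum_eq_zero fun k hk => ?_
      have h0 := hfz k (Finset.mem_range.1 hk)
      have h1 : a k = 0 := le_antisymm (by simpa [h0] using haM k) (ha k)
      simp [h0, h1]
    · simp [hfz k hk, hfb k (hfz k hk)]
  set m : ℝ := (∑ j ∈ Finset.range n, a j) / ∑ j ∈ Finset.range n, f j with hm
  have hmF : (∑ j ∈ Finset.range n, f j) * m = ∑ j ∈ Finset.range n, a j := by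
    rw [hm]; field_simp
  have hmI : m ∈ Icc (0 : ℝ) M := by
    refine ⟨div_nonneg (Finset.sum_nonneg fun _ _ => ha _) hF0, ?_⟩
    rw [hm, div_le_iff₀ hF, Finset.mul_sum]
    exact Finset.sum_le_sum fun _ _ => haM _
  set h : ℕ → ℝ := fun k => ∑ j ∈ Finset.range k, (f j * m - b j) with hh
  set g : ℕ → ℝ := fun k => ∑ j ∈ Finset.range k, (f j * m - a j) with hg
  have hgn : g n = 0 := by
    simp only [hg, Finset.sum_sub_distrib, ← Finset.sum_mul, hmF, sub_self]
  have hhn : h n = 0 := by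
    simp only [hh, Finset.sum_sub_distrib, ← Finset.sum_mul, hmF, htot, sub_self]
  have hhg : ∀ k ≤ n, h k ≤ g k := fun k hk => by
    simp only [hh, hg, Finset.sum_sub_distrib]; linarith [hmaj k hk]
  -- The averages `b / f` increase, so an initial segment averages at most the overall mean `m`.
  -- Cross-multiplication allows cells of zero mass.
  have hh0 : ∀ k ≤ n, 0 ≤ h k := by
    intro k hk
    have hsplit : ∀ u : ℕ → ℝ, ∑ j ∈ Finset.range n, u j =
        ∑ j ∈ Finset.range k, u j + ∑ j ∈ Finset.Ico k n, u j := fun u =>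
      (Finset.sum_range_add_sum_Ico u hk).symm
    have hcross : (∑ j ∈ Finset.range k, b j) * ∑ l ∈ Finset.Ico k n, f l ≤
        (∑ l ∈ Finset.Ico k n, b l) * ∑ j ∈ Finset.range k, f j := by
      rw [Finset.sum_mul_sum, Finset.sum_mul_sum, Finset.sum_comm]
      refine Finset.sum_le_sum fun l hl => Finset.sum_le_sum fun j hj => hmono j l ?_
      have := Finset.mem_range.1 hj; have := (Finset.mem_Ico.1 hl).1; omega
    have : 0 ≤ (∑ j ∈ Finset.range n, f j) * h k := by
      simp only [hh, Finset.sum_sub_distrib, ← Finset.sum_mul]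
      have e : (∑ j ∈ Finset.range n, f j) *
          ((∑ j ∈ Finset.range k, f j) * m - ∑ j ∈ Finset.range k, b j) =
          (∑ j ∈ Finset.range k, f j) * ((∑ j ∈ Finset.range n, f j) * m) -
          (∑ j ∈ Finset.range n, f j) * ∑ j ∈ Finset.range k, b j := by ring
      rw [e, hmF, htot, hsplit b, hsplit f]
      linarith
    exact nonneg_of_mul_nonneg_right this hF
  -- If `b` is proportional to `f`, the uninformative signal `m` works.
  by_cases hall : ∀ k < n, h k = 0
  · have hb : ∀ k < n, b k = f k * m := by
      intro k hk
      have h1 : h (k + 1) = 0 := by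
        rcases Nat.lt_or_ge (k + 1) n with h' | h'
        · exact hall _ h'
        · have : k + 1 = n := by omega
          rw [this, hhn]
      have h2 : h (k + 1) = h k + (f k * m - b k) := Finset.sum_range_succ _ _
      rw [h1, hall k hk] at h2
      linarith
    refine ⟨fun _ => Measure.dirac ⟨m, hmI⟩, fun _ => inferInstance, fun φ => ?_,
      fun k hk => ?_⟩
    · simp only [integral_dirac, ← Finset.sum_mul, Finset.sum_sub_distrib, ← Finset.mul_sum]
      rw [mul_comm m, hmF, sub_self, zero_mul]
    · simp [hb k hk]
  push Not at hall
  obtain ⟨k₀, hk₀, hhk₀⟩ := hall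
  obtain ⟨k, hk, hkmin⟩ := Finset.exists_min_image
    ((Finset.range n).filter fun k => h k ≠ 0) (fun k => g k / h k)
    ⟨k₀, by simp [hk₀, hhk₀]⟩
  simp only [Finset.mem_filter, Finset.mem_range] at hk hkmin
  obtain ⟨hkn, hhk⟩ := hk
  have hhkpos : 0 < h k := lt_of_le_of_ne (hh0 k hkn.le) (Ne.symm hhk)
  have hkpos : 0 < k := by
    rcases Nat.eq_zero_or_pos k with rfl | h'
    · simp [hh] at hhk
    · exact h'
  -- The largest factor by which `b` can be stretched away from the mean `m` without violating
  -- majorization. The constraint becomes tight at `k`, and `0 < k < n`, so both pieces are strictly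
  -- shorter.
  set r := g k / h k with hr
  have hr1 : 1 ≤ r := (one_le_div hhkpos).2 (hhg k hkn.le)
  have hrk : r * h k = g k := div_mul_cancel₀ _ hhk
  have hrl : ∀ l ≤ n, r * h l ≤ g l := by
    intro l hl
    rcases (hh0 l hl).eq_or_lt with h0 | h0
    · have := hhg l hl
      rw [← h0] at this ⊢
      simpa using this
    · have hln : l < n := lt_of_le_of_ne hl (by rintro rfl; exact h0.ne' hhn)
      exact (le_div_iff₀ h0).1 (hkmin l ⟨hln, h0.ne'⟩)
  set b' : ℕ → ℝ := fun j => f j * m + r * (b j - f j * m) with hb'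
  have hb's : ∀ l, ∑ j ∈ Finset.range l, b' j - ∑ j ∈ Finset.range l, a j = g l - r * h l := by
    intro l
    simp only [hg, hh, Finset.mul_sum, ← Finset.sum_sub_distrib, hb']
    exact Finset.sum_congr rfl fun _ _ => by ring
  have hb'0 : ∀ k, f k = 0 → b' k = 0 := fun k hk => by simp [hb', hk, hfb k hk]
  have hb'm : ∀ k l, k ≤ l → b' k * f l ≤ b' l * f k := by
    intro k l hkl
    have := mul_le_mul_of_nonneg_left (hmono k l hkl) (zero_le_one.trans hr1)
    simp only [hb']
    linarith
  have hk0 : ∑ j ∈ Finset.range k, b' j = ∑ j ∈ Finset.range k, a j := by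
    linarith [hb's k]
  obtain ⟨w₁, hw₁, hφ₁, hw₁b⟩ := ih k hkn f a b' hf ha haM hb'0 hb'm
    (fun l hl => by linarith [hb's l, hrl l (hl.trans hkn.le)]) hk0.symm
  have hshift : ∀ (u : ℕ → ℝ) l, ∑ j ∈ Finset.range (k + l), u j =
      ∑ j ∈ Finset.range k, u j + ∑ j ∈ Finset.range l, u (k + j) := fun u l =>
    Finset.sum_range_add u k l
  obtain ⟨w₂, hw₂, hφ₂, hw₂b⟩ := ih (n - k) (by omega) (fun j => f (k + j)) (fun j => a (k + j))
    (fun j => b' (k + j)) (fun _ => hf _) (fun _ => ha _) (fun _ => haM _) (fun _ => hb'0 _)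
    (fun _ _ hl => hb'm _ _ (by omega))
    (fun l hl => by
      have h1 := hb's (k + l)
      have h2 := hrl (k + l) (by omega)
      rw [hshift, hshift] at h1
      linarith)
    (by
      have h1 := hb's (k + (n - k))
      rw [hshift, hshift, Nat.add_sub_cancel' hkn.le, hgn, hhn] at h1
      linarith)
  set w : ℕ → Measure (Icc (0 : ℝ) M) := fun j => if j < k then w₁ j else w₂ (j - k) with hw
  have hwp : ∀ j, IsProbabilityMeasure (w j) := fun j => by
    simp only [hw]; split_ifs <;> infer_instance
  have hwφ : ∀ φ : C(Icc (0 : ℝ) M, ℝ),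
      ∑ k ∈ Finset.range n, ∫ s, (a k - s * f k) * φ s ∂(w k) = 0 := by
    intro φ
    rw [← Nat.add_sub_cancel' hkn.le, hshift]
    have e1 := hφ₁ φ
    have e2 := hφ₂ φ
    refine (congrArg₂ (· + ·) ?_ ?_).trans (add_zero (0 : ℝ))
    · refine Eq.trans (Finset.sum_congr rfl fun j hj => ?_) e1
      simp [hw, Finset.mem_range.1 hj]
    · refine Eq.trans (Finset.sum_congr rfl fun j hj => ?_) e2
      simp [hw]
  have hwb : ∀ j < n, f j * ∫ s, (s : ℝ) ∂(w j) = b' j := by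
    intro j hj
    by_cases hjk : j < k
    · simpa [hw, hjk] using hw₁b j hjk
    · have := hw₂b (j - k) (by omega)
      rw [Nat.add_sub_cancel' (not_lt.1 hjk)] at this
      simpa [hw, hjk] using this
  -- Mixing `w` with weight `r⁻¹` and the point mass at `m` with weight `1 - r⁻¹` turns means `b'`
  -- back into `b`. The added signal `m` is sent with the same probability from all cells, so it
  -- carries the mean quality `m` and the price condition survives.
  have hr0 : 0 < r := zero_lt_one.trans_le hr1
  have hrinv : r⁻¹ ≤ 1 := inv_le_one_of_one_le₀ hr1
  let t : NNReal := ⟨r⁻¹, (inv_pos.2 hr0).le⟩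
  let t' : NNReal := ⟨1 - r⁻¹, sub_nonneg.2 hrinv⟩
  have htt : t' + t = 1 := NNReal.eq (sub_add_cancel 1 r⁻¹)
  have hint : ∀ (j : ℕ) (ψ : C(Icc (0 : ℝ) M, ℝ)),
      ∫ s, ψ s ∂(t' • Measure.dirac (⟨m, hmI⟩ : Icc (0 : ℝ) M) + t • w j) =
        (1 - r⁻¹) * ψ ⟨m, hmI⟩ + r⁻¹ * ∫ s, ψ s ∂(w j) := by
    intro j ψ
    have hi : ∀ μ : Measure (Icc (0 : ℝ) M), IsFiniteMeasure μ → Integrable ψ μ := fun μ _ =>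
      ψ.continuous.integrable_of_hasCompactSupport (HasCompactSupport.of_compactSpace _)
    rw [integral_add_measure (hi _ inferInstance) (hi _ inferInstance),
      integral_smul_nnreal_measure, integral_smul_nnreal_measure, integral_dirac]
    rfl
  refine ⟨fun j => t' • Measure.dirac ⟨m, hmI⟩ + t • w j, fun j => ⟨?_⟩, fun φ => ?_,
    fun j hj => ?_⟩
  · simp only [Measure.add_apply, Measure.smul_apply, measure_univ]
    rw [← add_smul, htt, one_smul]
  · have e : ∀ j, ∫ s, (a j - s * f j) * φ s
        ∂(t' • Measure.dirac (⟨m, hmI⟩ : Icc (0 : ℝ) M) + t • w j) =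
        (1 - r⁻¹) * ((a j - m * f j) * φ ⟨m, hmI⟩) +
          r⁻¹ * ∫ s, (a j - s * f j) * φ s ∂(w j) := fun j =>
      hint j ⟨fun s => (a j - s * f j) * φ s, by fun_prop⟩
    simp only [e, Finset.sum_add_distrib, ← Finset.mul_sum, hwφ φ, ← Finset.sum_mul,
      Finset.sum_sub_distrib]
    rw [mul_comm m, hmF]
    ring
  · have e := hint j ⟨fun s => (s : ℝ), by fun_prop⟩
    simp only [ContinuousMap.coe_mk] at e
    have e2 := hwb j hj
    rw [e, mul_add, mul_left_comm (f j) r⁻¹, e2]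
    simp only [hb']
    field_simp
    ring

/-! ### Discretization of a general law of quality -/

/-- The integrals over the first `k` fibres of `c` add up to the integral over `{c < k}`. -/
theorem sum_setIntegral_fiber {α : Type*} [MeasurableSpace α] {ν : Measure α} {c : α → ℕ}
    (hc : Measurable c) {g : α → ℝ} (hg : Integrable g ν) (k : ℕ) :
    ∑ j ∈ Finset.range k, ∫ x in {x | c x = j}, g x ∂ν = ∫ x in {x | c x < k}, g x ∂ν := by
  have e : {x | c x < k} = ⋃ j ∈ Finset.range k, {x | c x = j} := by
    ext x; simp
  rw [e, integral_biUnion_finset]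
  · exact fun j _ => hc (measurableSet_singleton j)
  · intro i _ j _ hij
    exact Set.disjoint_left.2 fun x hx hx' => hij (hx.symm.trans hx')
  · exact fun _ _ => hg.integrableOn

/-- A joint law of quality and signal in which the signal is the expected quality given itself, and
the expected signal given the quality is `P` up to an error controlled by the mesh `1 / (n + 1)`. -/
theorem exists_discretized_law {M : ℝ} (hM : 0 ≤ M) (ν : Measure (Icc (0 : ℝ) M))
    [IsProbabilityMeasure ν] (P : Icc (0 : ℝ) M → Icc (0 : ℝ) M) (hP : Monotone P)
    (hmaj : ∀ c : ℝ, ∫ x in {x | (x : ℝ) < c}, (x : ℝ) ∂ν ≤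
      ∫ x in {x | (x : ℝ) < c}, (P x : ℝ) ∂ν)
    (htot : ∫ x, (x : ℝ) ∂ν = ∫ x, (P x : ℝ) ∂ν) (n : ℕ) :
    ∃ μ : ProbabilityMeasure (Icc (0 : ℝ) M × Icc (0 : ℝ) M),
      (μ : Measure (Icc (0 : ℝ) M × Icc (0 : ℝ) M)).fst = ν ∧
      (∀ φ : C(Icc (0 : ℝ) M, ℝ), ∫ z, ((z.1 : ℝ) - z.2) * φ z.2
        ∂(μ : Measure (Icc (0 : ℝ) M × Icc (0 : ℝ) M)) = 0) ∧
      ∀ (ψ : C(Icc (0 : ℝ) M, ℝ)) (ε : ℝ),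
        (∀ x y : Icc (0 : ℝ) M, |(x : ℝ) - y| ≤ 1 / (n + 1) → |ψ x - ψ y| ≤ ε) →
        |∫ z, (z.2 : ℝ) * ψ z.1 ∂(μ : Measure (Icc (0 : ℝ) M × Icc (0 : ℝ) M)) -
          ∫ x, (P x : ℝ) * ψ x ∂ν| ≤ M * ε := by
  have hn : (0 : ℝ) < n + 1 := by positivity
  set c : Icc (0 : ℝ) M → ℕ := fun x => ⌊(x : ℝ) * (n + 1)⌋₊ with hc_def
  have hc : Measurable c := Nat.measurable_floor.comp (by fun_prop)
  have hPm : Measurable P := hP.measurable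
  have hx0 : ∀ x : Icc (0 : ℝ) M, 0 ≤ (x : ℝ) * (n + 1) := fun x => mul_nonneg x.2.1 hn.le
  have hA : ∀ k, MeasurableSet {x | c x = k} := fun k => hc (measurableSet_singleton k)
  have hix : Integrable (fun x : Icc (0 : ℝ) M => (x : ℝ)) ν :=
    Integrable.of_bound (by fun_prop) M (.of_forall fun x => by
      rw [Real.norm_of_nonneg x.2.1]; exact x.2.2)
  have hiP : Integrable (fun x : Icc (0 : ℝ) M => (P x : ℝ)) ν :=
    Integrable.of_bound (by fun_prop) M (.of_forall fun x => by
      rw [Real.norm_of_nonneg (P x).2.1]; exact (P x).2.2)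
  set N : ℕ := ⌊M * (n + 1)⌋₊ + 1 with hN
  have hcN : ∀ x, c x < N := fun x => Nat.lt_succ_of_le
    (Nat.floor_le_floor (mul_le_mul_of_nonneg_right x.2.2 hn.le))
  have huniv : {x | c x < N} = univ := eq_univ_of_forall hcN
  have hlt : ∀ k : ℕ, {x | c x < k} = {x : Icc (0 : ℝ) M | (x : ℝ) < k / (n + 1)} := by
    intro k; ext x
    simp only [mem_ofPred_eq, hc_def, Nat.floor_lt (hx0 x), lt_div_iff₀ hn]
  -- For `k < l`, the value of `P` at the left end point of cell `l` separates the values of `P` on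
  -- the two cells. If cell `l` is empty, that point may lie outside `[0, M]`, but both sides
  -- vanish.
  have hcross : ∀ k l, k ≤ l → (∫ x in {x | c x = k}, (P x : ℝ) ∂ν) * ν.real {x | c x = l} ≤
      (∫ x in {x | c x = l}, (P x : ℝ) ∂ν) * ν.real {x | c x = k} := by
    intro k l hkl
    rcases hkl.eq_or_lt with rfl | hkl
    · exact le_rfl
    rcases eq_empty_or_nonempty {x | c x = l} with he | ⟨x₀, hx₀⟩
    · simp [he]
    have hy : (l : ℝ) / (n + 1) ∈ Icc (0 : ℝ) M := by
      refine ⟨by positivity, (div_le_iff₀ hn).2 ?_⟩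
      have h1 : (l : ℝ) ≤ x₀ * (n + 1) := by
        rw [← show c x₀ = l from hx₀]; exact Nat.floor_le (hx0 x₀)
      exact h1.trans (mul_le_mul_of_nonneg_right x₀.2.2 hn.le)
    have h1 : ∫ x in {x | c x = k}, (P x : ℝ) ∂ν ≤ P ⟨_, hy⟩ * ν.real {x | c x = k} := by
      calc ∫ x in {x | c x = k}, (P x : ℝ) ∂ν
          ≤ ∫ x in {x | c x = k}, (P ⟨_, hy⟩ : ℝ) ∂ν := by
            refine setIntegral_mono_on hiP.integrableOn (integrable_const _) (hA k) fun x hx => ?_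
            have : x ∈ {x | c x < l} := by rw [mem_ofPred_eq, show c x = k from hx]; exact hkl
            rw [hlt] at this
            exact hP (show x ≤ ⟨_, hy⟩ from le_of_lt this)
        _ = _ := by rw [setIntegral_const, smul_eq_mul, mul_comm]
    have h2 : P ⟨_, hy⟩ * ν.real {x | c x = l} ≤ ∫ x in {x | c x = l}, (P x : ℝ) ∂ν := by
      calc _ = ∫ x in {x | c x = l}, (P ⟨_, hy⟩ : ℝ) ∂ν := by
            rw [setIntegral_const, smul_eq_mul, mul_comm]
        _ ≤ _ := by
            refine setIntegral_mono_on (integrable_const _) hiP.integrableOn (hA l) fun x hx => ?_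
            have : x ∉ {x | c x < l} := by rw [mem_ofPred_eq, show c x = l from hx]; exact lt_irrefl _
            rw [hlt] at this
            exact hP (show ⟨_, hy⟩ ≤ x from not_lt.1 this)
    have h3 := mul_le_mul_of_nonneg_right h1 (measureReal_nonneg (μ := ν) (s := {x | c x = l}))
    have h4 := mul_le_mul_of_nonneg_right h2 (measureReal_nonneg (μ := ν) (s := {x | c x = k}))
    linarith
  obtain ⟨w, hw, hwφ, hwb⟩ := exists_signal_laws hM N (fun k => ν.real {x | c x = k})
    (fun k => ∫ x in {x | c x = k}, (x : ℝ) ∂ν) (fun k => ∫ x in {x | c x = k}, (P x : ℝ) ∂ν)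
    (fun _ => measureReal_nonneg) (fun k => setIntegral_nonneg (hA k) fun x _ => x.2.1)
    (fun k => by
      calc ∫ x in {x | c x = k}, (x : ℝ) ∂ν ≤ ∫ x in {x | c x = k}, M ∂ν :=
            setIntegral_mono_on hix.integrableOn (integrable_const _) (hA k) fun x _ => x.2.2
        _ = _ := by rw [setIntegral_const, smul_eq_mul, mul_comm])
    (fun k hk => setIntegral_measure_zero _ ((measureReal_eq_zero_iff).1 hk))
    hcross
    (fun k _ => by
      rw [sum_setIntegral_fiber hc hix, sum_setIntegral_fiber hc hiP, hlt]; exact hmaj _)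
    (by
      rw [sum_setIntegral_fiber hc hix, sum_setIntegral_fiber hc hiP, huniv]
      simpa using htot)
  let κ : Kernel (Icc (0 : ℝ) M) (Icc (0 : ℝ) M) := (Kernel.ofFunOfCountable w).comap c hc
  have hκ : ∀ x, κ x = w (c x) := fun x => rfl
  have : IsMarkovKernel κ := ⟨fun x => by rw [hκ]; exact hw _⟩
  have hint : ∀ h : C(Icc (0 : ℝ) M × Icc (0 : ℝ) M, ℝ),
      ∫ z, h z ∂(ν ⊗ₘ κ) = ∫ x, ∫ s, h (x, s) ∂(w (c x)) ∂ν := fun h => by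
    rw [Measure.integral_compProd (h.continuous.integrable_of_hasCompactSupport
      (HasCompactSupport.of_compactSpace _))]
    rfl
  have hic : ∀ (μ : Measure (Icc (0 : ℝ) M)) [IsFiniteMeasure μ] (ψ : Icc (0 : ℝ) M → ℝ),
      Continuous ψ → Integrable ψ μ := fun μ _ ψ hψ =>
    hψ.integrable_of_hasCompactSupport (HasCompactSupport.of_compactSpace _)
  refine ⟨⟨ν ⊗ₘ κ, inferInstance⟩, Measure.fst_compProd ν κ, fun φ => ?_, fun ψ ε hψ => ?_⟩
  · have e := hint ⟨fun z => ((z.1 : ℝ) - z.2) * φ z.2, by fun_prop⟩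
    simp only [ContinuousMap.coe_mk] at e
    have hinner : ∀ (k : ℕ) (x : ℝ), ∫ s, (x - (s : ℝ)) * φ s ∂(w k) =
        x * ∫ s, φ s ∂(w k) - ∫ s, s * φ s ∂(w k) := by
      intro k x
      rw [← integral_const_mul, ← integral_sub ((hic _ φ φ.continuous).const_mul x)
        (hic _ (fun s => (s : ℝ) * φ s) (by fun_prop))]
      simp only [sub_mul]
    refine e.trans ?_
    simp only [hinner]
    have hig : Integrable (fun x : Icc (0 : ℝ) M => (x : ℝ) * ∫ s, φ s ∂(w (c x)) - ∫ s, s * φ s ∂(w (c x))) ν := by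
      have h2 : Integrable (fun z : Icc (0 : ℝ) M × Icc (0 : ℝ) M => ((z.1 : ℝ) - z.2) * φ z.2)
          (ν ⊗ₘ κ) :=
        (show Continuous fun z : Icc (0 : ℝ) M × Icc (0 : ℝ) M => ((z.1 : ℝ) - z.2) * φ z.2 by
          fun_prop).integrable_of_hasCompactSupport (HasCompactSupport.of_compactSpace _)
      refine (Integrable.integral_compProd h2).congr (.of_forall fun x => ?_)
      exact hinner (c x) x
    rw [← setIntegral_univ, ← huniv, ← sum_setIntegral_fiber hc hig]
    refine Eq.trans (Finset.sum_congr rfl fun k _ => ?_) (hwφ φ)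
    have e1 : ∫ x in {x | c x = k}, ((x : ℝ) * ∫ s, φ s ∂(w (c x)) - ∫ s, s * φ s ∂(w (c x))) ∂ν =
        ∫ x in {x | c x = k}, ((x : ℝ) * ∫ s, φ s ∂(w k) - ∫ s, s * φ s ∂(w k)) ∂ν :=
      setIntegral_congr_fun (hA k) fun x hx => by simp only [show c x = k from hx]
    rw [e1, integral_sub (hix.integrableOn.mul_const _) (integrable_const _), integral_mul_const,
      setIntegral_const, smul_eq_mul]
    simp only [sub_mul, mul_assoc]
    rw [integral_sub ((hic _ φ φ.continuous).const_mul _), integral_const_mul]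
    · congr 1
      rw [← integral_const_mul]
      exact integral_congr_ae (.of_forall fun s => by ring)
    · exact hic _ (fun s => (s : ℝ) * (ν.real {x | c x = k} * φ s)) (by fun_prop)
  · have e := hint ⟨fun z => (z.2 : ℝ) * ψ z.1, by fun_prop⟩
    simp only [ContinuousMap.coe_mk] at e
    set m : ℕ → ℝ := fun k => ∫ s, (s : ℝ) ∂(w k) with hm
    have hmI : ∀ k, m k ∈ Icc (0 : ℝ) M := fun k => by
      refine ⟨integral_nonneg fun s => s.2.1, ?_⟩
      calc m k ≤ ∫ _, M ∂(w k) := integral_mono (hic _ (fun s => (s : ℝ)) (by fun_prop))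
            (integrable_const _) fun s => s.2.2
        _ = M := by simp
    have hmm : Measurable fun x => m (c x) := (measurable_from_nat (f := m)).comp hc
    obtain ⟨K, hK⟩ : ∃ K, ∀ x, ‖ψ x‖ ≤ K := ⟨‖ψ‖, ψ.norm_coe_le_norm⟩
    have hdiff : ∀ x, |m (c x) - P x| ≤ M := fun x =>
      abs_le.2 ⟨by linarith [(hmI (c x)).1, (P x).2.2], by linarith [(hmI (c x)).2, (P x).2.1]⟩
    have hid : Integrable (fun x => m (c x) - P x) ν :=
      Integrable.of_bound (by fun_prop) M (.of_forall hdiff)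
    let d : ℕ → Icc (0 : ℝ) M := fun k => projIcc 0 M hM (k / (n + 1))
    have hdm : Measurable fun x => ψ (d (c x)) :=
      (measurable_from_nat (f := fun k => ψ (d k))).comp hc
    have hd : ∀ x, |ψ x - ψ (d (c x))| ≤ ε := fun x => by
      refine hψ _ _ ?_
      have h1 : (c x : ℝ) / (n + 1) ≤ x := (div_le_iff₀ hn).2 (Nat.floor_le (hx0 x))
      have h2 : (x : ℝ) < (c x + 1) / (n + 1) := (lt_div_iff₀ hn).2 (Nat.lt_floor_add_one _)
      have h3 : (d (c x) : ℝ) = c x / (n + 1) := by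
        simp only [d]
        rw [projIcc_of_mem hM ⟨by positivity, h1.trans x.2.2⟩]
      rw [h3, abs_of_nonneg (by linarith)]
      rw [add_div] at h2
      linarith
    have hiψ : Integrable (fun x => (m (c x) - P x) * ψ x) ν :=
      hid.mul_bdd (by fun_prop) (.of_forall hK)
    have hid2 : Integrable (fun x => (m (c x) - P x) * ψ (d (c x))) ν :=
      hid.mul_bdd hdm.aestronglyMeasurable (.of_forall fun x => hK _)
    -- The mean signal and `P` have equal integrals on each cell, so they cannot be distinguished by
    -- a test function constant on cells; only the oscillation of `ψ` within a cell contributes to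
    -- the error.
    have hzero : ∫ x, (m (c x) - P x) * ψ (d (c x)) ∂ν = 0 := by
      rw [← setIntegral_univ, ← huniv, ← sum_setIntegral_fiber hc hid2]
      refine Finset.sum_eq_zero fun k hk => ?_
      have e1 : ∫ x in {x | c x = k}, (m (c x) - P x) * ψ (d (c x)) ∂ν =
          ∫ x in {x | c x = k}, (m k - P x) * ψ (d k) ∂ν :=
        setIntegral_congr_fun (hA k) fun x hx => by simp only [show c x = k from hx]
      rw [e1, integral_mul_const, integral_sub (integrable_const _) hiP.integrableOn,
        setIntegral_const, smul_eq_mul, hwb k (Finset.mem_range.1 hk), sub_self, zero_mul]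
    have hiPψ : Integrable (fun x => (P x : ℝ) * ψ x) ν :=
      hiP.mul_bdd (by fun_prop) (.of_forall hK)
    have e2 : ∫ x, ∫ s, (s : ℝ) * ψ x ∂(w (c x)) ∂ν - ∫ x, (P x : ℝ) * ψ x ∂ν =
        ∫ x, (m (c x) - P x) * (ψ x - ψ (d (c x))) ∂ν := by
      have e3 : ∫ x, ∫ s, (s : ℝ) * ψ x ∂(w (c x)) ∂ν =
          ∫ x, ((m (c x) - P x) * ψ x + P x * ψ x) ∂ν :=
        integral_congr_ae (.of_forall fun x => by simp only [integral_mul_const, hm]; ring)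
      rw [e3, integral_add hiψ hiPψ, add_sub_cancel_right]
      simp only [mul_sub]
      rw [integral_sub hiψ hid2, hzero, sub_zero]
    have e4 : ∫ z : Icc (0 : ℝ) M × Icc (0 : ℝ) M, (z.2 : ℝ) * ψ z.1 ∂(ν ⊗ₘ κ) -
        ∫ x, (P x : ℝ) * ψ x ∂ν = ∫ x, (m (c x) - P x) * (ψ x - ψ (d (c x))) ∂ν := by
      rw [e, e2]
    change |∫ z : Icc (0 : ℝ) M × Icc (0 : ℝ) M, (z.2 : ℝ) * ψ z.1 ∂(ν ⊗ₘ κ) -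
        ∫ x, (P x : ℝ) * ψ x ∂ν| ≤ M * ε
    rw [e4]
    have := norm_integral_le_of_norm_le_const (μ := ν) (C := M * ε)
      (f := fun x => (m (c x) - P x) * (ψ x - ψ (d (c x)))) (.of_forall fun x => by
        rw [norm_mul]
        exact mul_le_mul (hdiff x) (hd x) (norm_nonneg _) hM)
    simpa using this

/-! ### Weak limit and disintegration -/

/-- If `u` and `v` have the same integral against every continuous function of `T`, they have the
same integral over every event determined by `T`. -/
theorem setIntegral_preimage_eq_of_forall_continuous {E X : Type*} [MeasurableSpace E]
    [TopologicalSpace X] [CompactSpace X] [MeasurableSpace X] [BorelSpace X]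
    [HasOuterApproxClosed X] {μ : Measure E} [IsFiniteMeasure μ] {u v : E → ℝ} {T : E → X}
    (hT : Measurable T) (hu : Measurable u) (hv : Measurable v) (hui : Integrable u μ)
    (hvi : Integrable v μ) (hu0 : ∀ z, 0 ≤ u z) (hv0 : ∀ z, 0 ≤ v z)
    (h : ∀ φ : C(X, ℝ), ∫ z, u z * φ (T z) ∂μ = ∫ z, v z * φ (T z) ∂μ)
    {B : Set X} (hB : MeasurableSet B) :
    ∫ z in T ⁻¹' B, u z ∂μ = ∫ z in T ⁻¹' B, v z ∂μ := by
  -- The images under `T` of the measures with densities `u` and `v` are finite and agree on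
  -- continuous functions, hence coincide.
  have := isFiniteMeasure_withDensity_ofReal hui.2
  have := isFiniteMeasure_withDensity_ofReal hvi.2
  have key : ∀ {u : E → ℝ}, Measurable u → (∀ z, 0 ≤ u z) → ∀ φ : X → ℝ, Continuous φ →
      ∫ x, φ x ∂((μ.withDensity fun z => ENNReal.ofReal (u z)).map T) =
        ∫ z, u z * φ (T z) ∂μ := by
    intro u hu hu0 φ hφ
    rw [integral_map hT.aemeasurable hφ.measurable.aestronglyMeasurable,
      integral_withDensity_eq_integral_toReal_smul hu.ennreal_ofReal (by simp)]
    exact integral_congr_ae (.of_forall fun z => by simp [ENNReal.toReal_ofReal (hu0 z)])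
  have heq : (μ.withDensity fun z => ENNReal.ofReal (u z)).map T =
      (μ.withDensity fun z => ENNReal.ofReal (v z)).map T :=
    ext_of_forall_integral_eq_of_IsFiniteMeasure fun f => by
      rw [key hu hu0 f f.continuous, key hv hv0 f f.continuous]
      exact h f.toContinuousMap
  have hB' := congrArg (fun m : Measure X => (m B).toReal) heq
  simp only [Measure.map_apply hT hB, withDensity_apply _ (hT hB)] at hB'
  rw [integral_eq_lintegral_of_nonneg_ae (.of_forall hu0) hu.aestronglyMeasurable,
    integral_eq_lintegral_of_nonneg_ae (.of_forall hv0) hv.aestronglyMeasurable, hB']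

/-- The weak limit of the discretized laws. -/
theorem exists_coupling_of_majorized {M : ℝ} (hM : 0 ≤ M) (ν : Measure (Icc (0 : ℝ) M))
    [IsProbabilityMeasure ν] (P : Icc (0 : ℝ) M → Icc (0 : ℝ) M) (hP : Monotone P)
    (hmaj : ∀ c : ℝ, ∫ x in {x | (x : ℝ) < c}, (x : ℝ) ∂ν ≤
      ∫ x in {x | (x : ℝ) < c}, (P x : ℝ) ∂ν)
    (htot : ∫ x, (x : ℝ) ∂ν = ∫ x, (P x : ℝ) ∂ν) :
    ∃ μ : Measure (Icc (0 : ℝ) M × Icc (0 : ℝ) M), IsProbabilityMeasure μ ∧ μ.fst = ν ∧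
      (∀ φ : C(Icc (0 : ℝ) M, ℝ), ∫ z, ((z.1 : ℝ) - z.2) * φ z.2 ∂μ = 0) ∧
      ∀ ψ : C(Icc (0 : ℝ) M, ℝ), ∫ z, (z.2 : ℝ) * ψ z.1 ∂μ = ∫ x, (P x : ℝ) * ψ x ∂ν := by
  choose μ hfst hφ hψ using exists_discretized_law hM ν P hP hmaj htot
  -- Probability measures on a compact square form a compact space. All three requirements test `μ`
  -- against continuous functions; the possibly discontinuous `P` enters only through a number
  -- independent of `n`.
  obtain ⟨μ', -, hμ'⟩ := isCompact_univ.ultrafilter_le_nhds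
    ((Filter.hyperfilter ℕ).map μ) (by simp)
  have hlim : Filter.Tendsto μ (Filter.hyperfilter ℕ) (nhds μ') := hμ'
  have hcont : ∀ h : Icc (0 : ℝ) M × Icc (0 : ℝ) M → ℝ, Continuous h →
      Filter.Tendsto (fun n => ∫ z, h z ∂(μ n : Measure (Icc (0 : ℝ) M × Icc (0 : ℝ) M)))
        (Filter.hyperfilter ℕ)
        (nhds (∫ z, h z ∂(μ' : Measure (Icc (0 : ℝ) M × Icc (0 : ℝ) M)))) := fun h hh =>
    ProbabilityMeasure.tendsto_iff_forall_integral_tendsto.1 hlim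
      (BoundedContinuousFunction.mkOfCompact ⟨h, hh⟩)
  refine ⟨μ', inferInstance, ?_, fun φ => ?_, fun ψ => ?_⟩
  · refine ext_of_forall_integral_eq_of_IsFiniteMeasure fun f => ?_
    have hf := hcont (fun z => f z.1) (by fun_prop)
    have e : ∀ μ : Measure (Icc (0 : ℝ) M × Icc (0 : ℝ) M),
        ∫ z, f z.1 ∂μ = ∫ x, f x ∂μ.fst := fun μ =>
      (integral_map measurable_fst.aemeasurable
        f.continuous.measurable.aestronglyMeasurable).symm
    simp only [e, hfst] at hf
    exact (tendsto_nhds_unique hf tendsto_const_nhds)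
  · have hf := hcont (fun z => ((z.1 : ℝ) - z.2) * φ z.2) (by fun_prop)
    simp only [hφ] at hf
    exact tendsto_nhds_unique hf tendsto_const_nhds
  · have hf := (hcont (fun z => (z.2 : ℝ) * ψ z.1) (by fun_prop)).sub_const
      (∫ x, (P x : ℝ) * ψ x ∂ν) |>.abs
    refine sub_eq_zero.1 (abs_eq_zero.1 (le_antisymm (le_of_forall_pos_le_add fun ε hε => ?_)
      (abs_nonneg _)))
    rw [zero_add]
    refine le_of_tendsto hf (Filter.Eventually.filter_mono Nat.hyperfilter_le_atTop ?_)
    have hε' : 0 < ε / (M + 1) := by positivity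
    obtain ⟨δ, hδ, hu⟩ := Metric.uniformContinuous_iff.1
      (CompactSpace.uniformContinuous_of_continuous ψ.continuous) _ hε'
    have h1 : ∀ᶠ n : ℕ in Filter.atTop, 1 / ((n : ℝ) + 1) < δ :=
      tendsto_one_div_add_atTop_nhds_zero_nat.eventually (gt_mem_nhds hδ)
    filter_upwards [h1] with n hn
    refine (hψ n ψ (ε / (M + 1)) fun x y hxy => (hu (hxy.trans_lt hn)).le).trans ?_
    rw [← mul_div_assoc, div_le_iff₀ (by positivity)]
    nlinarith

/-- If a monotone `P` is majorized by the identity under `ν`, some signal, equal to the expected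
quality given itself, has mean `P x` at every quality `x`. -/
theorem exists_kernel_of_majorized {M : ℝ} (hM : 0 ≤ M) (ν : Measure (Icc (0 : ℝ) M))
    [IsProbabilityMeasure ν] (P : Icc (0 : ℝ) M → Icc (0 : ℝ) M) (hP : Monotone P)
    (hmaj : ∀ c : ℝ, ∫ x in {x | (x : ℝ) < c}, (x : ℝ) ∂ν ≤
      ∫ x in {x | (x : ℝ) < c}, (P x : ℝ) ∂ν)
    (htot : ∫ x, (x : ℝ) ∂ν = ∫ x, (P x : ℝ) ∂ν) :
    ∃ κ : Kernel (Icc (0 : ℝ) M) (Icc (0 : ℝ) M), IsMarkovKernel κ ∧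
      (∀ x, ∫ s, (s : ℝ) ∂(κ x) = P x) ∧
      ∀ B, MeasurableSet B →
        ∫ x, ∫ s in B, (x : ℝ) ∂(κ x) ∂ν = ∫ x, ∫ s in B, (s : ℝ) ∂(κ x) ∂ν := by
  obtain ⟨μ, _, hfst, hφ, hψ⟩ := exists_coupling_of_majorized hM ν P hP hmaj htot
  have : Nonempty (Icc (0 : ℝ) M) := ⟨⟨0, le_rfl, hM⟩⟩
  have hPm : Measurable P := hP.measurable
  have hb : ∀ {E : Type} [MeasurableSpace E] (ρ : Measure E) [IsFiniteMeasure ρ]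
      (u : E → Icc (0 : ℝ) M), Measurable u → Integrable (fun z => (u z : ℝ)) ρ :=
    fun ρ _ u hu => Integrable.of_bound (by fun_prop) M (.of_forall fun x => by
      rw [Real.norm_of_nonneg (u x).2.1]; exact (u x).2.2)
  have hS : ∀ B, MeasurableSet B → ∫ z in Prod.snd ⁻¹' B, (z.1 : ℝ) ∂μ =
      ∫ z in Prod.snd ⁻¹' B, (z.2 : ℝ) ∂μ := fun B hB => by
    refine setIntegral_preimage_eq_of_forall_continuous measurable_snd (by fun_prop)
      (by fun_prop) (hb μ _ measurable_fst) (hb μ _ measurable_snd) (fun z => z.1.2.1)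
      (fun z => z.2.2.1) (fun φ => ?_) hB
    have := hφ φ
    simp only [sub_mul] at this
    rw [integral_sub] at this
    · exact sub_eq_zero.1 this
    all_goals
      exact Continuous.integrable_of_hasCompactSupport (by fun_prop)
        (HasCompactSupport.of_compactSpace _)
  have hX : ∀ A, MeasurableSet A → ∫ z in Prod.fst ⁻¹' A, (z.2 : ℝ) ∂μ =
      ∫ z in Prod.fst ⁻¹' A, (P z.1 : ℝ) ∂μ := fun A hA => by
    refine setIntegral_preimage_eq_of_forall_continuous measurable_fst (by fun_prop)
      (by fun_prop) (hb μ _ measurable_snd) (hb μ _ (hPm.comp measurable_fst))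
      (fun z => z.2.2.1) (fun z => (P z.1).2.1) (fun ψ => ?_) hA
    rw [hψ ψ, ← hfst, Measure.fst, integral_map measurable_fst.aemeasurable]
    · rfl
    exact (hPm.subtype_val.mul ψ.continuous.measurable).aestronglyMeasurable
  set κ₀ := μ.condKernel with hκ₀
  have hdis : ν ⊗ₘ κ₀ = μ := by rw [← hfst]; exact μ.disintegrate _
  have hmm : Measurable fun x => ∫ s, (s : ℝ) ∂(κ₀ x) :=
    (StronglyMeasurable.integral_kernel (κ := κ₀)
      (f := fun s : Icc (0 : ℝ) M => (s : ℝ)) (by fun_prop)).measurable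
  have hmean : (fun x => ∫ s, (s : ℝ) ∂(κ₀ x)) =ᵐ[ν] fun x => (P x : ℝ) := by
    have hi2 : Integrable (fun z : Icc (0 : ℝ) M × Icc (0 : ℝ) M => (z.2 : ℝ)) (ν ⊗ₘ κ₀) :=
      hb _ _ measurable_snd
    refine Integrable.ae_eq_of_forall_setIntegral_eq _ _ (Integrable.integral_compProd hi2)
      (hb ν _ hPm) fun A hA _ => ?_
    have h1 := hX A hA
    rw [← hdis] at h1
    have h2 : (Prod.fst ⁻¹' A : Set (Icc (0 : ℝ) M × Icc (0 : ℝ) M)) = A ×ˢ univ := by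
      ext; simp
    have hi3 : Integrable (fun z : Icc (0 : ℝ) M × Icc (0 : ℝ) M => (P z.1 : ℝ)) (ν ⊗ₘ κ₀) :=
      hb _ _ (hPm.comp measurable_fst)
    rw [h2, Measure.setIntegral_compProd hA .univ hi2.integrableOn,
      Measure.setIntegral_compProd hA .univ hi3.integrableOn] at h1
    simpa using h1
  -- The disintegration has mean `P x` only for `ν`-almost every `x`, whereas sellers may deviate to
  -- any quality. Off `G` the signal is set to `P x`; this changes no integral over `ν`.
  set G : Set (Icc (0 : ℝ) M) := {x | ∫ s, (s : ℝ) ∂(κ₀ x) = P x} with hG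
  have hGm : MeasurableSet G := measurableSet_eq_fun hmm hPm.subtype_val
  classical
  let κ : Kernel (Icc (0 : ℝ) M) (Icc (0 : ℝ) M) :=
    Kernel.piecewise hGm κ₀ (Kernel.deterministic P hPm)
  have hκκ₀ : ∀ᵐ x ∂ν, κ x = κ₀ x := by
    filter_upwards [hmean] with x hx
    rw [Kernel.piecewise_apply, if_pos (show x ∈ G from hx)]
  refine ⟨κ, inferInstance, fun x => ?_, fun B hB => ?_⟩
  · rw [Kernel.piecewise_apply]
    split_ifs with hx
    · exact hx
    · simp [Kernel.deterministic_apply]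
  · have h1 := hS B hB
    rw [← hdis] at h1
    have h2 : (Prod.snd ⁻¹' B : Set (Icc (0 : ℝ) M × Icc (0 : ℝ) M)) = univ ×ˢ B := by
      ext; simp
    rw [h2, Measure.setIntegral_compProd .univ hB (hb _ _ measurable_fst).integrableOn,
      Measure.setIntegral_compProd .univ hB (hb _ _ measurable_snd).integrableOn,
      Measure.restrict_univ] at h1
    have h3 : ∀ g : Icc (0 : ℝ) M → Icc (0 : ℝ) M → ℝ,
        ∫ x, ∫ s in B, g x s ∂(κ x) ∂ν = ∫ x, ∫ s in B, g x s ∂(κ₀ x) ∂ν := fun g =>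
      integral_congr_ae (by filter_upwards [hκκ₀] with x hx; rw [hx])
    rw [h3 fun x _ => x, h3 fun _ s => s]
    exact h1

/-! ### Cost functions and incentive compatibility -/

namespace Rating

variable {a b : ℝ} {C : ℝ → ℝ → ℝ}

theorem IsCostFunction.differentiableOn_quality (hC : IsCostFunction a b C) {θ : ℝ}
    (hθ : θ ∈ Icc a b) : DifferentiableOn ℝ (fun y => C y θ) (Ici 0) :=
  (hC.contDiffOn.differentiableOn (by norm_num)).comp
    (f := fun y : ℝ => ((y, θ) : ℝ × ℝ)) (by fun_prop) fun _ hy => ⟨hy, hθ⟩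

theorem IsCostFunction.differentiableOn_type (hC : IsCostFunction a b C) {x : ℝ} (hx : 0 ≤ x) :
    DifferentiableOn ℝ (C x) (Icc a b) :=
  (hC.contDiffOn.differentiableOn (by norm_num)).comp
    (f := fun t : ℝ => ((x, t) : ℝ × ℝ)) (by fun_prop) fun _ ht => ⟨hx, ht⟩

theorem IsCostFunction.monotoneOn_quality (hC : IsCostFunction a b C) {θ : ℝ}
    (hθ : θ ∈ Icc a b) : MonotoneOn (fun y => C y θ) (Ici 0) := by
  have hd := hC.differentiableOn_quality hθ
  refine monotoneOn_of_deriv_nonneg (convex_Ici 0) hd.continuousOn (hd.mono interior_subset)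
    fun x hx => ?_
  rw [← derivWithin_of_mem_nhds (mem_interior_iff_mem_nhds.1 hx)]
  exact hC.costQ_nonneg x (interior_subset hx) θ hθ

theorem IsCostFunction.nonneg (hC : IsCostFunction a b C) {x θ : ℝ} (hx : 0 ≤ x)
    (hθ : θ ∈ Icc a b) : 0 ≤ C x θ := by
  have := hC.monotoneOn_quality hθ (mem_Ici.2 le_rfl) (mem_Ici.2 hx) hx
  simpa [hC.zero_cost θ hθ] using this

theorem IsCostFunction.exists_lipschitz_type (hC : IsCostFunction a b C) (M : ℝ) :
    ∃ K : NNReal, ∀ x ∈ Icc 0 M, LipschitzOnWith K (C x) (Icc a b) := by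
  obtain ⟨K, hK⟩ := (hC.contDiffOn.mono (prod_mono (fun x (hx : x ∈ Icc 0 M) => hx.1)
    subset_rfl)).exists_lipschitzOnWith (by norm_num) ((convex_Icc 0 M).prod (convex_Icc a b))
    (isCompact_Icc.prod isCompact_Icc)
  refine ⟨K, fun x hx => LipschitzOnWith.of_dist_le_mul fun t ht t' ht' => ?_⟩
  simpa [Prod.dist_eq] using hK.dist_le_mul (x, t) ⟨hx, ht⟩ (x, t') ⟨hx, ht'⟩

/-- The sign of `costQT` is informative only once `costQ` is known to be differentiable in the type.
This holds because `costQ` is a component of `fderivWithin`, which is `C¹` up to the boundary. -/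
theorem IsCostFunction.antitoneOn_costQ (hC : IsCostFunction a b C) {x : ℝ} (hx : 0 ≤ x) :
    AntitoneOn (costQ C x) (Icc a b) := by
  rcases lt_or_ge a b with hab | hab
  swap
  · exact (subsingleton_Icc_of_ge hab).antitoneOn _
  have hS : UniqueDiffOn ℝ (Ici (0 : ℝ) ×ˢ Icc a b) :=
    (uniqueDiffOn_Ici 0).prod (uniqueDiffOn_Icc hab)
  have hQ : ∀ t ∈ Icc a b, costQ C x t = fderivWithin ℝ (fun z : ℝ × ℝ => C z.1 z.2)
      (Ici 0 ×ˢ Icc a b) (x, t) (1, 0) := by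
    intro t ht
    have h1 := ((hC.contDiffOn.differentiableOn (by norm_num)) (x, t)
      ⟨hx, ht⟩).hasFDerivWithinAt
    have h2 : HasDerivWithinAt (fun y : ℝ => ((y, t) : ℝ × ℝ)) (1, 0) (Ici 0) x :=
      (hasDerivWithinAt_id x _).prodMk (hasDerivWithinAt_const x _ t)
    have h3 : MapsTo (fun y : ℝ => ((y, t) : ℝ × ℝ)) (Ici 0) (Ici 0 ×ˢ Icc a b) :=
      fun y hy => ⟨hy, ht⟩
    exact (h1.comp_hasDerivWithinAt x h2 h3).derivWithin
      (uniqueDiffOn_Ici 0 x hx)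
  have hd : DifferentiableOn ℝ (costQ C x) (Icc a b) := by
    refine DifferentiableOn.congr ?_ hQ
    have h1 := (hC.contDiffOn.fderivWithin hS (m := 1) (by norm_num)).differentiableOn
      (by norm_num)
    have h2 := h1.comp (f := fun t : ℝ => ((x, t) : ℝ × ℝ)) (s := Icc a b) (by fun_prop)
      fun t ht => ⟨hx, ht⟩
    exact h2.clm_apply (differentiableOn_const _)
  refine antitoneOn_of_deriv_nonpos (convex_Icc a b) hd.continuousOn (hd.mono interior_subset)
    fun t ht => ?_
  rw [← derivWithin_of_mem_nhds (mem_interior_iff_mem_nhds.1 ht)]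
  exact hC.costQT_nonpos x hx t (interior_subset ht)

theorem IsCostFunction.submodular (hC : IsCostFunction a b C) {x y : ℝ} (hx : 0 ≤ x)
    (hxy : x ≤ y) : AntitoneOn (fun t => C y t - C x t) (Icc a b) := by
  intro t ht t' ht' htt'
  have hd := (hC.differentiableOn_quality ht').sub (hC.differentiableOn_quality ht)
  have : AntitoneOn ((fun z => C z t') - fun z => C z t) (Ici 0) := by
    refine antitoneOn_of_deriv_nonpos (convex_Ici 0) hd.continuousOn (hd.mono interior_subset)
      fun z hz => ?_
    have hz0 : z ∈ Ici (0 : ℝ) := interior_subset hz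
    rw [← derivWithin_of_mem_nhds (mem_interior_iff_mem_nhds.1 hz), derivWithin_sub
      (hC.differentiableOn_quality ht' z hz0) (hC.differentiableOn_quality ht z hz0)]
    exact sub_nonpos.2 (hC.antitoneOn_costQ hz0 ht ht' htt')
  have := this (mem_Ici.2 hx) (mem_Ici.2 (hx.trans hxy)) hxy
  simp only [Pi.sub_apply] at this ⊢
  linarith

theorem IsCostFunction.costT_antitone (hC : IsCostFunction a b C) {x y θ : ℝ} (hx : 0 ≤ x)
    (hxy : x ≤ y) (hθ : θ ∈ Icc a b) : costT a b C y θ ≤ costT a b C x θ := by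
  have h := (hC.submodular hx hxy).derivWithin_nonpos (x := θ)
  rw [show (fun t => C y t - C x t) = C y - C x from rfl, derivWithin_sub
    (hC.differentiableOn_type (hx.trans hxy) θ hθ) (hC.differentiableOn_type hx θ hθ)] at h
  exact sub_nonpos.1 h

/-- The fundamental theorem of calculus applies, and `deriv` is `0` by convention at points of
non-differentiability, so a sign at the remaining points suffices. -/
theorem le_of_absolutelyContinuous_of_deriv_nonpos {f : ℝ → ℝ} {c d : ℝ} (hcd : c ≤ d)
    (hf : AbsolutelyContinuousOnInterval f c d)
    (h : ∀ t ∈ Ioo c d, DifferentiableAt ℝ f t → deriv f t ≤ 0) : f d ≤ f c := by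
  have h1 := hf.integral_deriv_eq_sub
  have h2 : ∫ x in c..d, deriv f x ≤ 0 := by
    rw [intervalIntegral.integral_of_le hcd, integral_Ioc_eq_integral_Ioo]
    refine setIntegral_nonpos measurableSet_Ioo fun t ht => ?_
    by_cases hd : DifferentiableAt ℝ f t
    · exact h t ht hd
    · exact (deriv_zero_of_not_differentiableAt hd).le
  linarith

/-- The envelope condition and monotonicity imply that no type gains by mimicking another. -/
theorem IsCostFunction.incentive_compatible (hC : IsCostFunction a b C) {q qbar : ℝ → ℝ}
    (hq : ∀ θ ∈ Icc a b, 0 ≤ q θ) (hqm : MonotoneOn q (Icc a b))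
    (henv : EnvelopeCondition a b C q qbar) {θ θ' : ℝ} (hθ : θ ∈ Icc a b) (hθ' : θ' ∈ Icc a b) :
    qbar θ' - C (q θ') θ ≤ profit C q qbar θ := by
  have hab : a ≤ b := hθ.1.trans hθ.2
  have hCac : AbsolutelyContinuousOnInterval (C (q θ')) a b := by
    obtain ⟨K, hK⟩ := hC.exists_lipschitz_type (q θ')
    exact LipschitzOnWith.absolutelyContinuousOnInterval (K := K)
      (by rw [uIcc_of_le hab]; exact hK _ ⟨hq _ hθ', le_rfl⟩)
  have hac := henv.1.add hCac
  have hder : ∀ t ∈ Ioo a b, DifferentiableAt ℝ (profit C q qbar + C (q θ')) t →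
      deriv (profit C q qbar + C (q θ')) t = costT a b C (q θ') t - costT a b C (q t) t := by
    intro t ht hd
    have hC' : DifferentiableAt ℝ (C (q θ')) t :=
      (hC.differentiableOn_type (hq _ hθ')).differentiableAt (Icc_mem_nhds ht.1 ht.2)
    have hP : DifferentiableAt ℝ (profit C q qbar) t := by
      simpa using hd.sub hC'
    rw [deriv_add hP hC', henv.2 t ht hP, costT, costT,
      derivWithin_of_mem_nhds (Icc_mem_nhds ht.1 ht.2),
      derivWithin_of_mem_nhds (Icc_mem_nhds ht.1 ht.2)]
    ring
  -- The function `Π + C (q θ')` falls before `θ'` and rises after it: its derivative at `t`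
  -- compares `costT` at `q θ'` and `q t`, which are ordered by monotonicity of `q`.
  have key : (profit C q qbar + C (q θ')) θ' ≤ (profit C q qbar + C (q θ')) θ := by
    rcases le_total θ θ' with h | h
    · refine le_of_absolutelyContinuous_of_deriv_nonpos h
        (hac.mono (by rw [uIcc_of_le hab, uIcc_of_le h]; exact Icc_subset_Icc hθ.1 hθ'.2))
        fun t ht hd => ?_
      have htI : t ∈ Ioo a b := ⟨hθ.1.trans_lt ht.1, ht.2.trans_le hθ'.2⟩
      have htI' := Ioo_subset_Icc_self htI
      rw [hder t htI hd]
      exact sub_nonpos.2 (hC.costT_antitone (hq t htI') (hqm htI' hθ' ht.2.le) htI')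
    · have := le_of_absolutelyContinuous_of_deriv_nonpos h
        (hac.neg.mono (by rw [uIcc_of_le hab, uIcc_of_le h]; exact Icc_subset_Icc hθ'.1 hθ.2))
        fun t ht hd => ?_
      · simp only [Pi.neg_apply] at this
        linarith
      have htI : t ∈ Ioo a b := ⟨hθ'.1.trans_lt ht.1, ht.2.trans_le hθ.2⟩
      have htI' := Ioo_subset_Icc_self htI
      rw [deriv.neg, hder t htI (by simpa using hd.neg)]
      linarith [hC.costT_antitone (hq _ hθ') (hqm hθ' htI' ht.1.le) htI']
  simp only [Pi.add_apply, profit] at key ⊢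
  linarith

/-! ### Integration over types -/

theorem ae_mem_Icc {F : Measure ℝ} [IsProbabilityMeasure F] (hF : F (Icc a b) = 1) :
    ∀ᵐ θ ∂F, θ ∈ Icc a b :=
  (mem_ae_iff_prob_eq_one measurableSet_Icc).2 hF

theorem le_of_measure_Icc {F : Measure ℝ} (hF : F (Icc a b) = 1) : a ≤ b := by
  by_contra h
  simp [Icc_eq_empty h] at hF

theorem aemeasurable_of_monotoneOn {F : Measure ℝ} [IsProbabilityMeasure F]
    (hF : F (Icc a b) = 1) {g : ℝ → ℝ} (hg : MonotoneOn g (Icc a b)) : AEMeasurable g F := by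
  have := aemeasurable_restrict_of_monotoneOn (μ := F) measurableSet_Icc hg
  rwa [Measure.restrict_eq_self_of_ae_mem (ae_mem_Icc hF)] at this

theorem integrable_of_monotoneOn {F : Measure ℝ} [IsProbabilityMeasure F]
    (hF : F (Icc a b) = 1) {g : ℝ → ℝ} (hg : MonotoneOn g (Icc a b)) : Integrable g F := by
  have hab := le_of_measure_Icc hF
  refine Integrable.of_bound (aemeasurable_of_monotoneOn hF hg).aestronglyMeasurable
    (max |g a| |g b|) ?_
  filter_upwards [ae_mem_Icc hF] with θ hθ
  exact abs_le_max_abs_abs (hg (left_mem_Icc.2 hab) hθ hθ.1) (hg hθ (right_mem_Icc.2 hab) hθ.2)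

/-- Majorization extends from the intervals `[a, θ]` to all lower sets of `[a, b]`. -/
theorem setIntegral_le_of_isLower {F : Measure ℝ} {q qbar : ℝ → ℝ} (hq : Integrable q F)
    (hqbar : Integrable qbar F)
    (h : ∀ θ ∈ Icc a b, ∫ t in Icc a θ, q t ∂F ≤ ∫ t in Icc a θ, qbar t ∂F) {L : Set ℝ}
    (hL : L ⊆ Icc a b) (hlow : ∀ x ∈ L, Icc a x ⊆ L) : ∫ t in L, q t ∂F ≤ ∫ t in L, qbar t ∂F := by
  rcases eq_empty_or_nonempty L with rfl | hne
  · simp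
  have hbdd : BddAbove L := bddAbove_Icc.mono hL
  have hlub := isLUB_csSup hne hbdd
  -- A lower set is `[a, sup L]` if the supremum belongs to it, and otherwise an increasing union of
  -- intervals `[a, u n]`.
  by_cases hs : sSup L ∈ L
  · have : L = Icc a (sSup L) :=
      (hlow _ hs).antisymm' fun x hx => ⟨(hL hx).1, hlub.1 hx⟩
    rw [this]
    exact h _ (hL hs)
  · obtain ⟨u, hu, -, hlim, huL⟩ := hlub.exists_seq_monotone_tendsto hne
    have hmono : Monotone fun n => Icc a (u n) := fun i j hij => Icc_subset_Icc_right (hu hij)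
    have hU : L = ⋃ n, Icc a (u n) := by
      refine Subset.antisymm (fun x hx => ?_) (iUnion_subset fun n => hlow _ (huL n))
      have hxs : x < sSup L := lt_of_le_of_ne (hlub.1 hx) fun h => hs (h ▸ hx)
      obtain ⟨n, hn⟩ := (hlim.eventually (lt_mem_nhds hxs)).exists
      exact mem_iUnion.2 ⟨n, (hL hx).1, hn.le⟩
    rw [hU]
    exact le_of_tendsto_of_tendsto'
      (tendsto_setIntegral_of_monotone (fun _ => measurableSet_Icc) hmono hq.integrableOn)
      (tendsto_setIntegral_of_monotone (fun _ => measurableSet_Icc) hmono hqbar.integrableOn)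
      fun n => h _ (hL (huL n))

/-! ### The price schedule and sufficiency -/

/-- The largest price of quality `x`, capped at `M`, that tempts no type away from the
profit `U`. -/
noncomputable def indirectPrice (a b : ℝ) (C : ℝ → ℝ → ℝ) (U : ℝ → ℝ) (M x : ℝ) : ℝ :=
  min M (⨅ θ : Icc a b, (U θ + C x θ))

section indirectPrice

variable {q qbar : ℝ → ℝ} {M : ℝ}

theorem bddBelow_indirectPrice (hC : IsCostFunction a b C)
    (hpart : ∀ θ ∈ Icc a b, 0 ≤ profit C q qbar θ) {x : ℝ} (hx : 0 ≤ x) :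
    BddBelow (range fun θ : Icc a b => profit C q qbar θ + C x θ) :=
  ⟨0, by rintro _ ⟨θ, rfl⟩; exact add_nonneg (hpart θ θ.2) (hC.nonneg hx θ.2)⟩

theorem indirectPrice_mem (hC : IsCostFunction a b C)
    (hpart : ∀ θ ∈ Icc a b, 0 ≤ profit C q qbar θ) (hM : 0 ≤ M) {x : ℝ} (hx : 0 ≤ x) :
    indirectPrice a b C (profit C q qbar) M x ∈ Icc 0 M :=
  ⟨le_min hM (Real.iInf_nonneg fun θ => add_nonneg (hpart θ θ.2) (hC.nonneg hx θ.2)),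
    min_le_left _ _⟩

theorem indirectPrice_mono (hC : IsCostFunction a b C)
    (hpart : ∀ θ ∈ Icc a b, 0 ≤ profit C q qbar θ) {x y : ℝ} (hx : 0 ≤ x) (hxy : x ≤ y) :
    indirectPrice a b C (profit C q qbar) M x ≤ indirectPrice a b C (profit C q qbar) M y :=
  min_le_min_left _ (ciInf_mono (bddBelow_indirectPrice hC hpart hx) fun θ =>
    add_le_add_right (hC.monotoneOn_quality θ.2 (mem_Ici.2 hx) (mem_Ici.2 (hx.trans hxy)) hxy) _)

theorem indirectPrice_sub_le (hC : IsCostFunction a b C)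
    (hpart : ∀ θ ∈ Icc a b, 0 ≤ profit C q qbar θ) {x θ : ℝ} (hx : 0 ≤ x) (hθ : θ ∈ Icc a b) :
    indirectPrice a b C (profit C q qbar) M x - C x θ ≤ profit C q qbar θ := by
  have h1 : indirectPrice a b C (profit C q qbar) M x ≤
      ⨅ θ : Icc a b, (profit C q qbar θ + C x θ) := min_le_right _ _
  have h2 := ciInf_le (bddBelow_indirectPrice hC hpart hx) ⟨θ, hθ⟩
  simp only at h2
  linarith

/-- Incentive compatibility says precisely that type `θ` attains the infimum at quality `q θ`; the
cap does not bind there. -/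
theorem indirectPrice_eq (hC : IsCostFunction a b C) (hq : ∀ θ ∈ Icc a b, 0 ≤ q θ)
    (himp : MonotoneOn q (Icc a b)) (henv : EnvelopeCondition a b C q qbar)
    (hpart : ∀ θ ∈ Icc a b, 0 ≤ profit C q qbar θ) {θ : ℝ} (hθ : θ ∈ Icc a b)
    (hM : qbar θ ≤ M) :
    indirectPrice a b C (profit C q qbar) M (q θ) = qbar θ := by
  refine le_antisymm ?_ (le_min hM ?_)
  · have := indirectPrice_sub_le (M := M) hC hpart (hq θ hθ) hθ
    simp only [profit] at this ⊢
    linarith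
  · have : Nonempty (Icc a b) := ⟨⟨θ, hθ⟩⟩
    exact le_ciInf fun θ' => by
      linarith [hC.incentive_compatible hq himp henv θ'.2 hθ]

end indirectPrice

theorem arisesInEquilibrium_of_implementable {F : Measure ℝ} [IsProbabilityMeasure F]
    (hF : F (Icc a b) = 1) (hC : IsCostFunction a b C) {q qbar : ℝ → ℝ}
    (hq : ∀ θ ∈ Icc a b, 0 ≤ q θ) (h : Implementable a b F C q qbar) :
    ArisesInEquilibrium a b F C q qbar := by
  obtain ⟨henv, ⟨hqm, hqbm, hmaj, htot⟩, hpart⟩ := h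
  have hab := le_of_measure_Icc hF
  have hbI : b ∈ Icc a b := right_mem_Icc.2 hab
  have hae := ae_mem_Icc hF
  have hqi := integrable_of_monotoneOn hF hqm
  have hqbi := integrable_of_monotoneOn hF hqbm
  -- This bounds all produced and all signaled qualities, so qualities and prices share the interval
  -- `[0, M]` and the cap in `indirectPrice` is harmless.
  set M : ℝ := max (q b) (qbar b) with hMdef
  have hM : 0 ≤ M := (hq b hbI).trans (le_max_left _ _)
  have hqI : ∀ θ ∈ Icc a b, q θ ∈ Icc 0 M := fun θ hθ =>
    ⟨hq θ hθ, (hqm hθ hbI hθ.2).trans (le_max_left _ _)⟩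
  have hqbM : ∀ θ ∈ Icc a b, qbar θ ≤ M := fun θ hθ =>
    (hqbm hθ hbI hθ.2).trans (le_max_right _ _)
  let G := indirectPrice a b C (profit C q qbar) M
  have hGq : ∀ θ ∈ Icc a b, G (q θ) = qbar θ := fun θ hθ =>
    indirectPrice_eq hC hq hqm henv hpart hθ (hqbM θ hθ)
  let P : Icc (0 : ℝ) M → Icc (0 : ℝ) M := fun x => ⟨G x, indirectPrice_mem hC hpart hM x.2.1⟩
  have hP : Monotone P := fun x y hxy => indirectPrice_mono hC hpart x.2.1 hxy
  let r : ℝ → Icc (0 : ℝ) M := fun θ => projIcc 0 M hM (q θ)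
  have hrq : ∀ θ ∈ Icc a b, (r θ : ℝ) = q θ := fun θ hθ => by
    simp only [r]; rw [projIcc_of_mem hM (hqI θ hθ)]
  have hrm : AEMeasurable r F :=
    continuous_projIcc.measurable.comp_aemeasurable (aemeasurable_of_monotoneOn hF hqm)
  have hPr : ∀ θ ∈ Icc a b, (P (r θ) : ℝ) = qbar θ := fun θ hθ => by
    simp only [P]; rw [hrq θ hθ, hGq θ hθ]
  set ν : Measure (Icc (0 : ℝ) M) := F.map r with hν
  have : IsProbabilityMeasure ν := Measure.isProbabilityMeasure_map hrm
  have hPm : Measurable P := hP.measurable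
  have htransfer : ∀ {B : Set (Icc (0 : ℝ) M)} {g : Icc (0 : ℝ) M → Icc (0 : ℝ) M}
      {u : ℝ → ℝ}, MeasurableSet B → Measurable g → (∀ θ ∈ Icc a b, (g (r θ) : ℝ) = u θ) →
      ∫ x in B, (g x : ℝ) ∂ν = ∫ θ in {θ ∈ Icc a b | r θ ∈ B}, u θ ∂F := by
    intro B g u hB hg hu
    rw [hν, setIntegral_map hB (by fun_prop) hrm]
    have e : (r ⁻¹' B : Set ℝ) =ᵐ[F] {θ ∈ Icc a b | r θ ∈ B} := by
      filter_upwards [hae] with θ hθ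
      exact propext ⟨fun h => ⟨hθ, h⟩, fun h => h.2⟩
    rw [setIntegral_congr_set e]
    refine integral_congr_ae (ae_restrict_of_ae ?_)
    filter_upwards [hae] with θ hθ using hu θ hθ
  have hlt : ∀ c : ℝ, MeasurableSet {x : Icc (0 : ℝ) M | (x : ℝ) < c} := fun c =>
    measurableSet_lt measurable_subtype_coe measurable_const
  obtain ⟨κ, hκ, hκmean, hκprice⟩ := exists_kernel_of_majorized hM ν P hP
    (fun c => by
      rw [htransfer (hlt c) hPm hPr]
      refine (htransfer (hlt c) measurable_id hrq).trans_le ?_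
      refine setIntegral_le_of_isLower hqi hqbi hmaj (fun _ hx => hx.1) fun x hx y hy => ?_
      have hyI : y ∈ Icc a b := ⟨hy.1, hy.2.trans hx.1.2⟩
      refine ⟨hyI, ?_⟩
      have hx2 : (r x : ℝ) < c := hx.2
      change (r y : ℝ) < c
      rw [hrq x hx.1] at hx2
      rw [hrq y hyI]
      exact (hqm hyI hx.1 hy.2).trans_lt hx2)
    (by
      have e1 := htransfer .univ measurable_id hrq
      have e2 := htransfer .univ hPm hPr
      simp only [mem_univ, and_true, Measure.restrict_univ, id_eq] at e1 e2
      rw [e1, e2]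
      exact htot.symm)
  -- Qualities above `M` are rated like `M`, and the price of a signal is the signal itself.
  let R : RatingSystem :=
    { S := Icc (0 : ℝ) M
      π := κ.comap (projIcc 0 M hM) continuous_projIcc.measurable }
  have hπ : ∀ x, R.π x = κ (projIcc 0 M hM x) := fun x => rfl
  let p : R.S → ℝ := fun s => (s : Icc (0 : ℝ) M).1
  have hpm : Measurable p := measurable_subtype_coe
  have hpb : ∀ (E : Type) [MeasurableSpace E] (ρ : Measure E) [IsFiniteMeasure ρ] (T : E → R.S),
      Measurable T → Integrable (fun z => p (T z)) ρ := fun E _ ρ _ T hT =>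
    Integrable.of_bound (hpm.comp hT).aestronglyMeasurable M (.of_forall fun z => by
      rw [Real.norm_of_nonneg (T z).2.1]; exact (T z).2.2)
  have hmean : ∀ x, 0 ≤ x → ∃ y ∈ Icc 0 x, ∫ s, p s ∂(R.π x) = G y ∧ (x ≤ M → y = x) := by
    intro x hx
    refine ⟨projIcc 0 M hM x, ⟨(projIcc 0 M hM x).2.1, ?_⟩, hκmean _, fun hxM => ?_⟩
    · simp [coe_projIcc, hx]
    · rw [projIcc_of_mem hM ⟨hx, hxM⟩]
  have hmeanq : ∀ θ ∈ Icc a b, ∫ s, p s ∂(R.π (q θ)) = qbar θ := fun θ hθ => by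
    obtain ⟨y, -, hy, hyx⟩ := hmean (q θ) (hq θ hθ)
    rw [hy, hyx (hqI θ hθ).2, hGq θ hθ]
  have hqmap : F.map q = ν.map Subtype.val := by
    rw [hν, AEMeasurable.map_map_of_aemeasurable measurable_subtype_coe.aemeasurable hrm]
    refine Measure.map_congr ?_
    filter_upwards [hae] with θ hθ using (hrq θ hθ).symm
  have : IsProbabilityMeasure (F.map q) :=
    Measure.isProbabilityMeasure_map (aemeasurable_of_monotoneOn hF hqm)
  have hJ : IsProbabilityMeasure (jointLaw F R q) := by
    unfold jointLaw; infer_instance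
  have hi1 : Integrable (fun z : ℝ × R.S => z.1) (jointLaw F R q) := by
    have h1 : Integrable id (jointLaw F R q).fst := by
      rw [jointLaw, Measure.fst_compProd,
        integrable_map_measure aestronglyMeasurable_id (aemeasurable_of_monotoneOn hF hqm)]
      exact hqi
    exact h1.comp_measurable measurable_fst
  have hi2 : Integrable (fun z : ℝ × R.S => p z.2) (jointLaw F R q) :=
    hpb _ _ _ measurable_snd
  have hJint : ∀ (f : ℝ × R.S → ℝ), Integrable f (jointLaw F R q) → ∀ B : Set R.S,
      MeasurableSet B → ∫ z in Prod.snd ⁻¹' B, f z ∂(jointLaw F R q) =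
        ∫ x : Icc (0 : ℝ) M, ∫ s in B, f (x, s) ∂(κ x) ∂ν := by
    intro f hf B hB
    have e : (Prod.snd ⁻¹' B : Set (ℝ × R.S)) = univ ×ˢ B := by ext; simp
    rw [e]
    unfold jointLaw at hf ⊢
    rw [Measure.setIntegral_compProd .univ hB hf.integrableOn,
      Measure.restrict_univ, hqmap,
      (MeasurableEmbedding.subtype_coe measurableSet_Icc).integral_map]
    simp only [hπ, projIcc_val]
    rfl
  refine ⟨R, p, hqi, ⟨hpm, fun s => s.2.1, ?_⟩, fun x _ => hpb _ _ _ measurable_id,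
    fun θ hθ => (hmeanq θ hθ).symm, fun θ hθ => ⟨hq θ hθ, fun x hx => ?_⟩, fun θ hθ => ?_⟩
  · refine ae_eq_condExp_of_forall_setIntegral_eq measurable_snd.comap_le hi1
      (fun _ _ _ => hi2.integrableOn) ?_ ?_
    · rintro _ ⟨B, hB, rfl⟩ -
      rw [hJint _ hi1 B hB, hJint _ hi2 B hB]
      exact (hκprice B hB).symm
    · exact (hpm.comp (comap_measurable Prod.snd)).aestronglyMeasurable
  -- A deviation to `x` earns the price of its truncation `y ≤ x` and costs at least as much as `y`,
  -- so it is no better than `y` itself.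
  · obtain ⟨y, hy, hyx, -⟩ := hmean x hx
    rw [hyx, hmeanq θ hθ]
    have h1 := indirectPrice_sub_le (M := M) hC hpart hy.1 hθ
    have h2 := hC.monotoneOn_quality hθ (mem_Ici.2 hy.1) (mem_Ici.2 hx) hy.2
    simp only [profit] at h1 h2
    simp only [G]
    linarith
  · rw [hmeanq θ hθ]
    exact hpart θ hθ

end Rating

/-! ### Necessity -/

namespace Rating

variable {a b : ℝ} {C : ℝ → ℝ → ℝ} {F : Measure ℝ} {R : RatingSystem} {p : R.S → ℝ}
  {q qbar : ℝ → ℝ}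

namespace IsEquilibrium

theorem profit_eq (h : IsEquilibrium a b F C R p q qbar) {θ : ℝ} (hθ : θ ∈ Icc a b) :
    profit C q qbar θ = (∫ s, p s ∂(R.π (q θ))) - C (q θ) θ := by
  rw [profit, h.signaled θ hθ]

theorem incentive (h : IsEquilibrium a b F C R p q qbar) {θ θ' : ℝ} (hθ : θ ∈ Icc a b)
    (hθ' : θ' ∈ Icc a b) : qbar θ' - C (q θ') θ ≤ profit C q qbar θ := by
  rw [h.profit_eq hθ, h.signaled θ' hθ']
  exact (h.optimal θ hθ).2 _ (h.optimal θ' hθ').1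

theorem monotoneOn_quality (h : IsEquilibrium a b F C R p q qbar)
    (hC : StrictlySubmodular a b C) : MonotoneOn q (Icc a b) := by
  intro θ hθ θ' hθ' hle
  rcases hle.eq_or_lt with rfl | hlt
  · exact le_rfl
  by_contra! hq
  have h1 := h.incentive hθ hθ'
  have h2 := h.incentive hθ' hθ
  have h3 := hC (q θ') (q θ) (h.optimal θ' hθ').1 hq θ hθ θ' hθ' hlt
  simp only [profit] at h1 h2
  linarith

theorem monotoneOn_signaled (h : IsEquilibrium a b F C R p q qbar) (hC : IsCostFunction a b C)
    (hq : MonotoneOn q (Icc a b)) : MonotoneOn qbar (Icc a b) := by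
  intro θ hθ θ' hθ' hle
  have h1 := h.incentive hθ' hθ
  have h2 := hC.monotoneOn_quality hθ' (h.optimal θ hθ).1 (h.optimal θ' hθ').1 (hq hθ hθ' hle)
  simp only [profit] at h1 h2
  linarith

theorem envelopeCondition (h : IsEquilibrium a b F C R p q qbar) (hab : a ≤ b)
    (hC : IsCostFunction a b C) (hq : MonotoneOn q (Icc a b)) :
    EnvelopeCondition a b C q qbar := by
  constructor
  · obtain ⟨K, hK⟩ := hC.exists_lipschitz_type (q b)
    have hqI : ∀ θ ∈ Icc a b, q θ ∈ Icc 0 (q b) := fun θ hθ =>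
      ⟨(h.optimal θ hθ).1, hq hθ (right_mem_Icc.2 hab) hθ.2⟩
    refine LipschitzOnWith.absolutelyContinuousOnInterval (K := K) ?_
    rw [uIcc_of_le hab]
    refine LipschitzOnWith.of_le_add_mul K fun θ hθ θ' hθ' => ?_
    have h1 := h.incentive hθ' hθ
    have h2 := (hK _ (hqI θ hθ)).dist_le_mul θ' hθ' θ hθ
    rw [Real.dist_eq, dist_comm] at h2
    have h3 := le_abs_self (C (q θ) θ' - C (q θ) θ)
    have h4 : profit C q qbar θ = qbar θ - C (q θ) θ := rfl
    linarith
  · intro θ hθ hd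
    have hθI := Ioo_subset_Icc_self hθ
    have hnhds := Icc_mem_nhds hθ.1 hθ.2
    have hC' : DifferentiableAt ℝ (C (q θ)) θ :=
      (hC.differentiableOn_type (h.optimal θ hθI).1).differentiableAt hnhds
    -- No type `t` gains by mimicking `θ`, and equality holds at `t = θ`.
    have hmin : IsLocalMin (profit C q qbar + C (q θ)) θ := by
      filter_upwards [hnhds] with t ht
      have := h.incentive ht hθI
      simp only [Pi.add_apply, profit] at this ⊢
      linarith
    have := hmin.deriv_eq_zero
    rw [deriv_add hd hC'] at this
    rw [costT, derivWithin_of_mem_nhds hnhds]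
    linarith

/-- Signaled quality has the mean of quality and is less dispersed (Jensen's inequality). -/
theorem integral_max_sub_le [IsProbabilityMeasure F] (h : IsEquilibrium a b F C R p q qbar)
    (hF : F (Icc a b) = 1) (c : ℝ) :
    Integrable qbar F ∧ ∫ θ, qbar θ ∂F = ∫ θ, q θ ∂F ∧
      ∫ θ, max (c - qbar θ) 0 ∂F ≤ ∫ θ, max (c - q θ) 0 ∂F := by
  have hae := ae_mem_Icc hF
  have hqm := h.integrable_quality.aemeasurable
  have hmap : IsProbabilityMeasure (F.map q) := Measure.isProbabilityMeasure_map hqm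
  set J := jointLaw F R q with hJdef
  have hJ : IsProbabilityMeasure J := by
    rw [hJdef, jointLaw]; infer_instance
  have hfst : J.fst = F.map q := Measure.fst_compProd _ _
  have hi1 : Integrable (fun z : ℝ × R.S => z.1) J := by
    have h1 : Integrable id J.fst := by
      rw [hfst, integrable_map_measure aestronglyMeasurable_id hqm]
      exact h.integrable_quality
    exact h1.comp_measurable measurable_fst
  have hi2 : Integrable (fun z : ℝ × R.S => p z.2) J :=
    integrable_condExp.congr h.price.eq_condExp.symm
  have hset : ∀ B : Set R.S, MeasurableSet B → ∫ z in Prod.snd ⁻¹' B, p z.2 ∂J =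
      ∫ z in Prod.snd ⁻¹' B, z.1 ∂J := fun B hB => by
    rw [← setIntegral_condExp measurable_snd.comap_le hi1 ⟨B, hB, rfl⟩]
    exact integral_congr_ae (ae_restrict_of_ae h.price.eq_condExp)
  have hprod : ∀ f : ℝ × R.S → ℝ, Integrable f J →
      Integrable (fun θ => ∫ s, f (q θ, s) ∂(R.π (q θ))) F ∧
        ∫ z, f z ∂J = ∫ θ, ∫ s, f (q θ, s) ∂(R.π (q θ)) ∂F := by
    intro f hf
    have h1 : Integrable (fun x => ∫ s, f (x, s) ∂(R.π x)) (F.map q) :=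
      Integrable.integral_compProd hf
    refine ⟨h1.comp_aemeasurable hqm, ?_⟩
    rw [hJdef, jointLaw, Measure.integral_compProd hf, integral_map hqm h1.aestronglyMeasurable]
  have hqbar : (fun θ => ∫ s, p s ∂(R.π (q θ))) =ᵐ[F] qbar := by
    filter_upwards [hae] with θ hθ using (h.signaled θ hθ).symm
  have hqbi : Integrable qbar F := (hprod _ hi2).1.congr hqbar
  refine ⟨hqbi, ?_, ?_⟩
  · have h1 := hset univ .univ
    simp only [preimage_univ, Measure.restrict_univ] at h1
    rw [(hprod _ hi2).2, (hprod _ hi1).2] at h1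
    simpa [integral_congr_ae hqbar] using h1
  · have hip : Integrable (fun z : ℝ × R.S => max (c - p z.2) 0) J :=
      ((integrable_const c).sub hi2).pos_part
    have hix : Integrable (fun z : ℝ × R.S => max (c - z.1) 0) J :=
      ((integrable_const c).sub hi1).pos_part
    have hB : MeasurableSet {s | p s < c} := measurableSet_lt h.price.measurable measurable_const
    have hB' : MeasurableSet (Prod.snd ⁻¹' {s | p s < c} : Set (ℝ × R.S)) := measurable_snd hB
    have h1 : ∫ θ, max (c - qbar θ) 0 ∂F ≤ ∫ z, max (c - p z.2) 0 ∂J := by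
      rw [(hprod _ hip).2]
      refine integral_mono_ae ((integrable_const c).sub hqbi).pos_part (hprod _ hip).1 ?_
      filter_upwards [hae] with θ hθ
      have hpi := h.integrable_price (q θ) (h.optimal θ hθ).1
      refine max_le ?_ (integral_nonneg fun _ => le_max_right _ _)
      calc c - qbar θ = ∫ s, (c - p s) ∂(R.π (q θ)) := by
            rw [integral_sub (integrable_const _) hpi, h.signaled θ hθ]; simp
        _ ≤ _ := integral_mono ((integrable_const c).sub hpi)
            ((integrable_const c).sub hpi).pos_part fun _ => le_max_left _ _
    -- The event that the price lies below `c` is determined by the signal, so price may be replaced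
    -- by quality on it.
    have h2 : ∫ z, max (c - p z.2) 0 ∂J = ∫ z in Prod.snd ⁻¹' {s | p s < c}, (c - z.1) ∂J := by
      have e : ∫ z, max (c - p z.2) 0 ∂J =
          ∫ z in Prod.snd ⁻¹' {s | p s < c}, (c - p z.2) ∂J := by
        rw [← integral_indicator hB']
        refine integral_congr_ae (.of_forall fun z => ?_)
        by_cases hz : p z.2 < c
        · rw [indicator_of_mem (show z ∈ Prod.snd ⁻¹' {s | p s < c} from hz)]
          exact max_eq_left (sub_nonneg.2 hz.le)
        · rw [indicator_of_notMem (show z ∉ Prod.snd ⁻¹' {s | p s < c} from hz)]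
          exact max_eq_right (sub_nonpos.2 (not_lt.1 hz))
      rw [e, integral_sub (integrable_const _) hi2.integrableOn,
        integral_sub (integrable_const _) hi1.integrableOn, hset _ hB]
    have h3 : ∫ z in Prod.snd ⁻¹' {s | p s < c}, (c - z.1) ∂J ≤ ∫ z, max (c - z.1) 0 ∂J :=
      (integral_mono ((integrable_const c).sub hi1).integrableOn hix.integrableOn
        fun _ => le_max_left _ _).trans
        (setIntegral_le_integral hix (.of_forall fun _ => le_max_right _ _))
    have h4 : ∫ z, max (c - z.1) 0 ∂J = ∫ θ, max (c - q θ) 0 ∂F := by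
      rw [(hprod _ hix).2]
      simp
    linarith

/-- Take the dispersion inequality at level `c = q θ`. As `q` is increasing, the positive part of `q
θ - q` is exactly its restriction to `[a, θ]`, while for `qbar` the restriction is at most the
positive part. -/
theorem fMajorizes [IsProbabilityMeasure F] (h : IsEquilibrium a b F C R p q qbar)
    (hF : F (Icc a b) = 1) (hq : MonotoneOn q (Icc a b)) : FMajorizes a b F q qbar := by
  have hae := ae_mem_Icc hF
  have hqi := h.integrable_quality
  obtain ⟨hqbi, htot, -⟩ := h.integral_max_sub_le hF 0
  refine ⟨fun θ hθ => ?_, ?_⟩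
  · obtain ⟨-, -, hle⟩ := h.integral_max_sub_le hF (q θ)
    have h1 : ∫ t in Icc a θ, (q θ - qbar t) ∂F ≤ ∫ t, max (q θ - qbar t) 0 ∂F := by
      have hi := ((integrable_const (μ := F) (q θ)).sub hqbi)
      exact (integral_mono hi.integrableOn hi.pos_part.integrableOn
        fun _ => le_max_left _ _).trans
        (setIntegral_le_integral hi.pos_part (.of_forall fun _ => le_max_right _ _))
    have h2 : ∫ t, max (q θ - q t) 0 ∂F = ∫ t in Icc a θ, (q θ - q t) ∂F := by
      rw [← integral_indicator measurableSet_Icc]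
      refine integral_congr_ae ?_
      filter_upwards [hae] with t ht
      by_cases htθ : t ≤ θ
      · rw [indicator_of_mem (show t ∈ Icc a θ from ⟨ht.1, htθ⟩)]
        exact max_eq_left (sub_nonneg.2 (hq ht hθ htθ))
      · rw [indicator_of_notMem (fun h : t ∈ Icc a θ => htθ h.2)]
        exact max_eq_right (sub_nonpos.2 (hq hθ ht (not_le.1 htθ).le))
    rw [integral_sub (integrable_const _) hqbi.integrableOn] at h1
    rw [integral_sub (integrable_const _) hqi.integrableOn] at h2
    linarith
  · rwa [Measure.restrict_eq_self_of_ae_mem hae]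

theorem implementable [IsProbabilityMeasure F] (h : IsEquilibrium a b F C R p q qbar)
    (hF : F (Icc a b) = 1) (hC : IsCostFunction a b C) (hq : MonotoneOn q (Icc a b)) :
    Implementable a b F C q qbar :=
  ⟨h.envelopeCondition (le_of_measure_Icc hF) hC hq,
    ⟨hq, h.monotoneOn_signaled hC hq, h.fMajorizes hF hq⟩,
    fun θ hθ => by rw [h.profit_eq hθ]; exact h.participation θ hθ⟩

end IsEquilibrium

end Rating

theorem mainTheorem2 (a b : ℝ) (F : Measure ℝ) [IsProbabilityMeasure F]
    (hF : F (Icc a b) = 1) (hatoms : {θ : ℝ | F {θ} ≠ 0}.Finite)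
    (C : ℝ → ℝ → ℝ) (hC : Rating.IsCostFunction a b C)
    (q qbar : ℝ → ℝ) (hq : ∀ θ ∈ Icc a b, 0 ≤ q θ) :
    (Rating.StrictlySubmodular a b C →
      (Rating.ArisesInEquilibrium a b F C q qbar ↔ Rating.Implementable a b F C q qbar)) ∧
    (MonotoneOn q (Icc a b) →
      (Rating.ArisesInEquilibrium a b F C q qbar ↔ Rating.Implementable a b F C q qbar)) :=
  ⟨fun hsub => ⟨fun ⟨_, _, h⟩ => h.implementable hF hC (h.monotoneOn_quality hsub),
      Rating.arisesInEquilibrium_of_implementable hF hC hq⟩,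
    fun hqm => ⟨fun ⟨_, _, h⟩ => h.implementable hF hC hqm,
      Rating.arisesInEquilibrium_of_implementable hF hC hq⟩⟩
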